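/- Let $(\mathcal M,\tau)$ be a tracial $\mathrm W^*$-algebra (a von Neumann algebra with a faithful normal tracial state), let $\mathcal P\subseteq\mathcal M$ be a (unital) $\mathrm W^*$-subalgebra, and write $\|a\|_2=\tau(a^*a)^{1/2}$. Let $\mathbf x=(x_i)_{i\in I}$ be a tuple of self-adjoint elements that generates $\mathcal M$ as a von Neumann algebra, where $I$ is an arbitrary index set, and let $R_i>0$ with $\|x_i\|\le R_i$. Let $\Omega$ be a probability space and, for each $k\in\mathbb N$, let $n(k)\ge 1$ and let $\mathbf X^{(k)}=(X^{(k)}_i)_{i\in I}$ be a tuple of random self-adjoint $n(k)\times n(k)$ complex matrices on $\Omega$ with $\|X^{(k)}_i\|\le R_i$ almost surely. Let $\tau_n=\frac1n\operatorname{Tr}$ and assume that $\tau_{n(k)}(p(\mathbf X^{(k)}))\to\tau(p(\mathbf x))$ in probability as $k\to\infty$ for every non-commutative polynomial $p\in\mathbb C\langle t_i:i\in I\rangle$. For tracial algebras $(A_k,\tau_k)$ and a free ultrafilter $\omega$ on $\mathbb N$, let $\prod_{k\to\omega}A_k$ be the tracial ultraproduct, that is, the $*$-algebra of norm-bounded sequences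 $(a_k)_k$, $a_k\in A_k$, modulo those with $\lim_{k\to\omega}\tau_k(a_k^*a_k)=0$, with trace $[(a_k)_k]\mapsto\lim_{k\to\omega}\tau_k(a_k)$. It is applied to $M_{n(k)}(\mathbb C)$ with the trace $\tau_{n(k)}$, and to $L^\infty(\Omega,M_{n(k)}(\mathbb C))$ with the trace $f\mapsto\mathbb E[\tau_{n(k)}(f)]$. Let $$\iota_\omega:\prod_{k\to\omega}M_{n(k)}(\mathbb C)\to\prod_{k\to\omega}L^\infty(\Omega,M_{n(k)}(\mathbb C))$$ be the inclusion induced by viewing matrices as constant functions on $\Omega$. Then there is a unique trace-preserving conditional expectation $E_{\mathcal P}:\mathcal M\to\mathcal P$. For every free ultrafilter $\omega$ on $\mathbb N$ there are a unique trace-preserving unital $*$-homomorphism $\rho_\omega:\mathcal M\to\prod_{k\to\omega}L^\infty(\Omega,M_{n(k)}(\mathbb C))$ with $\rho_\omega(x_i)=[(X^{(k)}_i)_k]$ for all $i\in I$, and a unique trace-preserving conditional expectation $E_\omega:\prod_{k\to\omega}L^\infty(\Omega,M_{n(k)}(\mathbb C))\to\prod_{k\to\omega}M_{n(k)}(\mathbb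 C)$ (with respect to $\iota_\omega$). Moreover, the following are equivalent: 1. (External averaging property) For every non-commutative polynomial $p$, $$\lim_{k\to\infty}\big\|\mathbb E[p(\mathbf X^{(k)})]\big\|_2=\big\|E_{\mathcal P}[p(\mathbf x)]\big\|_2,$$ where the norm on the left is the $2$-norm of $(M_{n(k)}(\mathbb C),\tau_{n(k)})$. 2. For every free ultrafilter $\omega$ on $\mathbb N$, $$\rho_\omega(\mathcal P)=\rho_\omega(\mathcal M)\cap\iota_\omega\Big(\prod_{k\to\omega}M_{n(k)}(\mathbb C)\Big)$$ and $\iota_\omega\circ E_\omega\circ\rho_\omega=\rho_\omega\circ E_{\mathcal P}$ on $\mathcal M$. -/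

import Mathlib

open MeasureTheory Filter
open scoped ComplexOrder ENNReal Topology Matrix.Norms.L2Operator

noncomputable section

/-- A tracial state on a unital complex `*`-algebra: a linear functional `τ` with `τ 1 = 1`,
`τ (a* a) ≥ 0` and `τ (a b) = τ (b a)`. -/
structure TracialState (A : Type*) [Ring A] [StarRing A] [Algebra ℂ A] extends A →ₗ[ℂ] ℂ where
  map_one' : toFun 1 = 1
  nonneg' : ∀ a, 0 ≤ toFun (star a * a)
  tracial' : ∀ a b, toFun (a * b) = toFun (b * a)

namespace TracialState

section Basic

variable {A : Type*} [Ring A] [StarRing A] [Algebra ℂ A]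

instance : CoeFun (TracialState A) (fun _ => A → ℂ) := ⟨fun τ => τ.toLinearMap⟩

theorem map_one (τ : TracialState A) : τ 1 = 1 := τ.map_one'
theorem nonneg (τ : TracialState A) (a : A) : 0 ≤ τ (star a * a) := τ.nonneg' a
theorem tracial (τ : TracialState A) (a b : A) : τ (a * b) = τ (b * a) := τ.tracial' a b

/-- The `2`-norm `‖a‖₂ = τ(a* a)^{1/2}`. -/
def twoNorm (τ : TracialState A) (a : A) : ℝ := √(τ (star a * a)).re

/-- `τ` is faithful: `τ (a* a) = 0` only for `a = 0`. -/
def IsFaithful (τ : TracialState A) : Prop := ∀ a : A, τ (star a * a) = 0 → a = 0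

end Basic

section CStar

variable {A : Type*} [CStarAlgebra A] (τ : TracialState A)

theorem exists_seminorm_facts :
    (∀ a b, τ.twoNorm (a + b) ≤ τ.twoNorm a + τ.twoNorm b) ∧
    (∀ a b, τ.twoNorm (a * b) ≤ ‖a‖ * τ.twoNorm b) ∧
    (∀ a, ‖τ a‖ ≤ τ.twoNorm a) ∧ (∀ a, τ.twoNorm a ≤ ‖a‖) := by
  let _ := CStarAlgebra.spectralOrder A
  have _ := CStarAlgebra.spectralOrderedRing A
  let f : A →ₚ[ℂ] ℂ := PositiveLinearMap.mk₀ τ.toLinearMap (by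
    intro a ha
    obtain ⟨b, rfl⟩ := (CStarAlgebra.nonneg_iff_eq_star_mul_self (a := a)).1 ha
    exact τ.nonneg b)
  have hf : ∀ a, f a = τ a := fun _ => rfl
  have h2 : ∀ a, τ.twoNorm a = ‖f.toPreGNS a‖ := by
    intro a
    rw [PositiveLinearMap.preGNS_norm_def]
    rfl
  have h1 : ‖f.toPreGNS 1‖ = 1 := by
    rw [← h2, twoNorm]
    simp [τ.map_one]
  have hmul : ∀ a b, τ.twoNorm (a * b) ≤ ‖a‖ * τ.twoNorm b := by
    intro a b
    have h := (f.leftMulMapPreGNS a).le_opNorm (f.toPreGNS b)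
    have hn : ‖f.leftMulMapPreGNS a‖ ≤ ‖a‖ :=
      LinearMap.mkContinuous_norm_le _ (norm_nonneg a) _
    rw [h2, h2]
    refine le_trans ?_ (mul_le_mul_of_nonneg_right hn (norm_nonneg _))
    simpa using h
  refine ⟨?_, hmul, ?_, ?_⟩
  · intro a b
    rw [h2, h2, h2, map_add]
    exact norm_add_le _ _
  · intro a
    have h := norm_inner_le_norm (𝕜 := ℂ) (f.toPreGNS 1) (f.toPreGNS a)
    rw [PositiveLinearMap.preGNS_inner_def, h1, one_mul] at h
    rw [h2]
    simpa [hf] using h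
  · intro a
    have h := hmul a 1
    rwa [mul_one, h2 1, h1, mul_one] at h

theorem twoNorm_nonneg {A : Type*} [Ring A] [StarRing A] [Algebra ℂ A] (τ : TracialState A)
    (a : A) : 0 ≤ τ.twoNorm a := Real.sqrt_nonneg _

theorem twoNorm_add_le (a b : A) : τ.twoNorm (a + b) ≤ τ.twoNorm a + τ.twoNorm b :=
  τ.exists_seminorm_facts.1 a b

theorem twoNorm_mul_le (a b : A) : τ.twoNorm (a * b) ≤ ‖a‖ * τ.twoNorm b :=
  τ.exists_seminorm_facts.2.1 a b

theorem norm_apply_le_twoNorm (a : A) : ‖τ a‖ ≤ τ.twoNorm a := τ.exists_seminorm_facts.2.2.1 a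

theorem twoNorm_le_norm (a : A) : τ.twoNorm a ≤ ‖a‖ := τ.exists_seminorm_facts.2.2.2 a

theorem norm_apply_le (a : A) : ‖τ a‖ ≤ ‖a‖ :=
  (τ.norm_apply_le_twoNorm a).trans (τ.twoNorm_le_norm a)

theorem twoNorm_star (a : A) : τ.twoNorm (star a) = τ.twoNorm a := by
  rw [twoNorm, twoNorm, star_star, τ.tracial]

theorem twoNorm_mul_le' (a b : A) : τ.twoNorm (a * b) ≤ τ.twoNorm a * ‖b‖ := by
  rw [← twoNorm_star, star_mul, mul_comm]
  refine (τ.twoNorm_mul_le _ _).trans ?_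
  rw [twoNorm_star, norm_star]

end CStar

end TracialState

/-! ### The C*-algebra `L^∞(Ω, A)` -/

/-- `L^∞(Ω, A)`: essentially bounded random variables with values in `A`, modulo almost sure
equality. -/
def Linfty {Ω : Type*} [MeasurableSpace Ω] (μ : Measure Ω) (A : Type*) [CStarAlgebra A] : Type _ :=
  Lp A ∞ μ

namespace Linfty

variable {Ω : Type*} [MeasurableSpace Ω] {μ : Measure Ω} {A : Type*} [CStarAlgebra A]

instance : NormedAddCommGroup (Linfty μ A) := inferInstanceAs (NormedAddCommGroup (Lp A ∞ μ))
instance : NormedSpace ℂ (Linfty μ A) := inferInstanceAs (NormedSpace ℂ (Lp A ∞ μ))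
instance : CompleteSpace (Linfty μ A) := inferInstanceAs (CompleteSpace (Lp A ∞ μ))
instance : InvolutiveStar (Linfty μ A) := inferInstanceAs (InvolutiveStar (Lp A ∞ μ))

/-- A representative `Ω → A` of an element of `L^∞(Ω, A)`. -/
def toFn (f : Linfty μ A) : Ω → A := AEEqFun.cast (Subtype.val (p := fun g => g ∈ Lp A ∞ μ) f)

instance : CoeFun (Linfty μ A) (fun _ => Ω → A) := ⟨toFn⟩

theorem aesm (f : Linfty μ A) : AEStronglyMeasurable f μ := Lp.aestronglyMeasurable (E := A) f

theorem ext_ae {f g : Linfty μ A} (h : f =ᵐ[μ] g) : f = g := Lp.ext (E := A) h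

theorem ae_norm_le (f : Linfty μ A) : ∀ᵐ w ∂μ, ‖f w‖ ≤ ‖f‖ := by
  have h : ∀ᵐ w ∂μ, ‖f w‖ₑ ≤ eLpNormEssSup f μ := ae_le_eLpNormEssSup
  have hn : ‖f‖ = (eLpNormEssSup f μ).toReal := by
    rw [← eLpNorm_exponent_top]; rfl
  have ht : eLpNormEssSup f μ ≠ ∞ := by
    rw [← eLpNorm_exponent_top]; exact Lp.eLpNorm_ne_top (E := A) f
  filter_upwards [h] with w hw
  rw [hn, ← toReal_enorm]
  exact ENNReal.toReal_mono ht hw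

theorem norm_le {f : Linfty μ A} {C : ℝ} (hC : 0 ≤ C) (h : ∀ᵐ w ∂μ, ‖f w‖ ≤ C) : ‖f‖ ≤ C := by
  have hn : ‖f‖ = (eLpNormEssSup f μ).toReal := by
    rw [← eLpNorm_exponent_top]; rfl
  rw [hn]
  exact ENNReal.toReal_le_of_le_ofReal hC (eLpNormEssSup_le_of_ae_bound h)

/-- The class in `L^∞(Ω, A)` of an almost surely bounded random variable. -/
def ofBounded (f : Ω → A) (hf : AEStronglyMeasurable f μ) (hb : ∃ C : ℝ, ∀ᵐ w ∂μ, ‖f w‖ ≤ C) :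
    Linfty μ A :=
  MemLp.toLp f (p := ∞) (μ := μ)
    ⟨hf, by
      obtain ⟨C, hC⟩ := hb
      rw [eLpNorm_exponent_top]
      exact eLpNormEssSup_lt_top_of_ae_bound hC⟩

theorem coeFn_ofBounded (f : Ω → A) (hf : AEStronglyMeasurable f μ)
    (hb : ∃ C : ℝ, ∀ᵐ w ∂μ, ‖f w‖ ≤ C) : ofBounded f hf hb =ᵐ[μ] f :=
  MemLp.coeFn_toLp _

instance : Mul (Linfty μ A) where
  mul f g := ofBounded (fun w => f w * g w) (f.aesm.mul g.aesm) ⟨‖f‖ * ‖g‖, by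
    filter_upwards [f.ae_norm_le, g.ae_norm_le] with w h1 h2
    exact (norm_mul_le _ _).trans (mul_le_mul h1 h2 (norm_nonneg _) (norm_nonneg _))⟩

instance : One (Linfty μ A) where
  one := ofBounded (fun _ => 1) aestronglyMeasurable_const ⟨‖(1 : A)‖, by simp⟩

theorem coeFn_mul (f g : Linfty μ A) : (f * g : Linfty μ A) =ᵐ[μ] fun w => f w * g w :=
  coeFn_ofBounded _ _ _
theorem coeFn_one : (1 : Linfty μ A) =ᵐ[μ] fun _ => (1 : A) := coeFn_ofBounded _ _ _
theorem coeFn_add (f g : Linfty μ A) : (f + g : Linfty μ A) =ᵐ[μ] fun w => f w + g w :=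
  Lp.coeFn_add (E := A) f g
theorem coeFn_zero : (0 : Linfty μ A) =ᵐ[μ] fun _ => (0 : A) := Lp.coeFn_zero A ∞ μ
theorem coeFn_smul (c : ℂ) (f : Linfty μ A) : (c • f : Linfty μ A) =ᵐ[μ] fun w => c • f w :=
  Lp.coeFn_smul (E := A) c f
theorem coeFn_star (f : Linfty μ A) : (star f : Linfty μ A) =ᵐ[μ] fun w => star (f w) :=
  Lp.coeFn_star (R := A) f

instance : Ring (Linfty μ A) :=
  { (inferInstance : AddCommGroup (Linfty μ A)), (inferInstance : Mul (Linfty μ A)),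
    (inferInstance : One (Linfty μ A)) with
    mul_assoc := fun f g h => ext_ae (by
      filter_upwards [coeFn_mul (f * g) h, coeFn_mul f g, coeFn_mul f (g * h), coeFn_mul g h]
        with w h1 h2 h3 h4
      rw [h1, h2, h3, h4, mul_assoc])
    one_mul := fun f => ext_ae (by
      filter_upwards [coeFn_mul 1 f, coeFn_one (μ := μ) (A := A)] with w h1 h2
      rw [h1, h2, one_mul])
    mul_one := fun f => ext_ae (by
      filter_upwards [coeFn_mul f 1, coeFn_one (μ := μ) (A := A)] with w h1 h2
      rw [h1, h2, mul_one])
    zero_mul := fun f => ext_ae (by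
      filter_upwards [coeFn_mul 0 f, coeFn_zero (μ := μ) (A := A)] with w h1 h2
      rw [h1, h2, zero_mul])
    mul_zero := fun f => ext_ae (by
      filter_upwards [coeFn_mul f 0, coeFn_zero (μ := μ) (A := A)] with w h1 h2
      rw [h1, h2, mul_zero])
    left_distrib := fun f g h => ext_ae (by
      filter_upwards [coeFn_mul f (g + h), coeFn_add g h, coeFn_add (f * g) (f * h),
        coeFn_mul f g, coeFn_mul f h] with w h1 h2 h3 h4 h5
      rw [h1, h2, h3, h4, h5, mul_add])
    right_distrib := fun f g h => ext_ae (by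
      filter_upwards [coeFn_mul (f + g) h, coeFn_add f g, coeFn_add (f * h) (g * h),
        coeFn_mul f h, coeFn_mul g h] with w h1 h2 h3 h4 h5
      rw [h1, h2, h3, h4, h5, add_mul]) }

instance : CStarAlgebra (Linfty μ A) :=
  { (inferInstance : NormedAddCommGroup (Linfty μ A)), (inferInstance : Ring (Linfty μ A)),
    (inferInstance : InvolutiveStar (Linfty μ A)), (inferInstance : CompleteSpace (Linfty μ A)) with
    norm_mul_le := fun f g => norm_le (by positivity) (by
      filter_upwards [coeFn_mul f g, f.ae_norm_le, g.ae_norm_le] with w h h1 h2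
      rw [h]
      exact (norm_mul_le _ _).trans (mul_le_mul h1 h2 (norm_nonneg _) (norm_nonneg _)))
    star_mul := fun f g => ext_ae (by
      filter_upwards [coeFn_star (f * g), coeFn_mul f g, coeFn_mul (star g) (star f),
        coeFn_star f, coeFn_star g] with w h1 h2 h3 h4 h5
      rw [h1, h2, h3, h4, h5, star_mul])
    star_add := fun f g => ext_ae (by
      filter_upwards [coeFn_star (f + g), coeFn_add f g, coeFn_add (star f) (star g),
        coeFn_star f, coeFn_star g] with w h1 h2 h3 h4 h5
      rw [h1, h2, h3, h4, h5, star_add])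
    norm_mul_self_le := fun f => by
      rw [← sq, ← Real.le_sqrt (norm_nonneg _) (norm_nonneg _)]
      refine norm_le (Real.sqrt_nonneg _) ?_
      filter_upwards [coeFn_star f, coeFn_mul (star f) f, (star f * f).ae_norm_le] with w h1 h2 h3
      rw [h2, h1, CStarRing.norm_star_mul_self] at h3
      exact Real.le_sqrt_of_sq_le (by rw [sq]; exact h3)
    smul := fun c f => c • f
    algebraMap :=
      { toFun := fun c => c • (1 : Linfty μ A)
        map_one' := one_smul _ _
        map_zero' := zero_smul _ _
        map_add' := fun a b => add_smul _ _ _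
        map_mul' := fun a b => ext_ae (by
          filter_upwards [coeFn_smul (a * b) (1 : Linfty μ A), coeFn_smul a (1 : Linfty μ A),
            coeFn_smul b (1 : Linfty μ A), coeFn_mul (a • (1 : Linfty μ A)) (b • 1),
            coeFn_one (μ := μ) (A := A)] with w h1 h2 h3 h4 h5
          rw [h1, h4, h2, h3, h5, smul_mul_smul_comm, one_mul]) }
    commutes' := fun c f => ext_ae (by
      filter_upwards [coeFn_smul c (1 : Linfty μ A), coeFn_mul (c • (1 : Linfty μ A)) f,
        coeFn_mul f (c • (1 : Linfty μ A)), coeFn_one (μ := μ) (A := A)] with w h1 h2 h3 h4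
      change (c • (1 : Linfty μ A) * f : Linfty μ A) w = (f * c • (1 : Linfty μ A) : Linfty μ A) w
      rw [h2, h3, h1, h4]
      simp)
    smul_def' := fun c f => ext_ae (by
      filter_upwards [coeFn_smul c (1 : Linfty μ A), coeFn_mul (c • (1 : Linfty μ A)) f,
        coeFn_smul c f, coeFn_one (μ := μ) (A := A)] with w h1 h2 h3 h4
      change (c • f : Linfty μ A) w = (c • (1 : Linfty μ A) * f : Linfty μ A) w
      rw [h2, h3, h1, h4]
      simp)
    norm_smul_le := fun c f => (norm_smul_le c f :)
    star_smul := fun c f => ext_ae (by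
      filter_upwards [coeFn_star (c • f), coeFn_smul c f, coeFn_smul (star c) (star f),
        coeFn_star f] with w h1 h2 h3 h4
      change (star (c • f) : Linfty μ A) w = (star c • star f : Linfty μ A) w
      rw [h1, h2, h3, h4, star_smul]) }


/-- The canonical inclusion `A → L^∞(Ω, A)` as deterministic (constant) functions. -/
def const (μ : Measure Ω) (A : Type*) [CStarAlgebra A] : A →⋆ₐ[ℂ] Linfty μ A where
  toFun a := ofBounded (fun _ => a) aestronglyMeasurable_const ⟨‖a‖, by simp⟩
  map_one' := rfl
  map_mul' a b := ext_ae (by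
    filter_upwards [coeFn_ofBounded (μ := μ) (fun _ => a) aestronglyMeasurable_const ⟨‖a‖, by simp⟩,
      coeFn_ofBounded (μ := μ) (fun _ => b) aestronglyMeasurable_const ⟨‖b‖, by simp⟩,
      coeFn_ofBounded (μ := μ) (fun _ => a * b) aestronglyMeasurable_const ⟨‖a * b‖, by simp⟩,
      coeFn_mul (μ := μ) (ofBounded (fun _ => a) aestronglyMeasurable_const ⟨‖a‖, by simp⟩)
        (ofBounded (fun _ => b) aestronglyMeasurable_const ⟨‖b‖, by simp⟩)] with w h1 h2 h3 h4
    rw [h3, h4, h1, h2])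
  map_zero' := ext_ae (by
    filter_upwards [coeFn_ofBounded (μ := μ) (fun _ => (0 : A)) aestronglyMeasurable_const
      ⟨‖(0 : A)‖, by simp⟩, coeFn_zero (μ := μ) (A := A)] with w h1 h2
    rw [h1, h2])
  map_add' a b := ext_ae (by
    filter_upwards [coeFn_ofBounded (μ := μ) (fun _ => a) aestronglyMeasurable_const ⟨‖a‖, by simp⟩,
      coeFn_ofBounded (μ := μ) (fun _ => b) aestronglyMeasurable_const ⟨‖b‖, by simp⟩,
      coeFn_ofBounded (μ := μ) (fun _ => a + b) aestronglyMeasurable_const ⟨‖a + b‖, by simp⟩,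
      coeFn_add (μ := μ) (ofBounded (fun _ => a) aestronglyMeasurable_const ⟨‖a‖, by simp⟩)
        (ofBounded (fun _ => b) aestronglyMeasurable_const ⟨‖b‖, by simp⟩)] with w h1 h2 h3 h4
    rw [h3, h4, h1, h2])
  commutes' c := ext_ae (by
    filter_upwards [coeFn_ofBounded (μ := μ) (fun _ => algebraMap ℂ A c) aestronglyMeasurable_const
      ⟨‖algebraMap ℂ A c‖, by simp⟩, coeFn_smul c (1 : Linfty μ A),
      coeFn_one (μ := μ) (A := A)] with w h1 h2 h3
    change _ = (c • (1 : Linfty μ A) : Linfty μ A) w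
    rw [h1, h2, h3, Algebra.algebraMap_eq_smul_one])
  map_star' a := ext_ae (by
    filter_upwards [coeFn_ofBounded (μ := μ) (fun _ => a) aestronglyMeasurable_const ⟨‖a‖, by simp⟩,
      coeFn_ofBounded (μ := μ) (fun _ => star a) aestronglyMeasurable_const ⟨‖star a‖, by simp⟩,
      coeFn_star (μ := μ) (ofBounded (fun _ => a) aestronglyMeasurable_const ⟨‖a‖, by simp⟩)]
      with w h1 h2 h3
    rw [h2, h3, h1])

theorem coeFn_const (a : A) : const μ A a =ᵐ[μ] fun _ => a :=
  coeFn_ofBounded (fun _ => a) aestronglyMeasurable_const ⟨‖a‖, by simp⟩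

theorem integrable [IsProbabilityMeasure μ] (f : Linfty μ A) : Integrable f μ :=
  Integrable.of_bound f.aesm ‖f‖ f.ae_norm_le

/-- The tracial state `f ↦ ∫ τ(f) dμ` on `L^∞(Ω, A)`. -/
def tracialState (μ : Measure Ω) [IsProbabilityMeasure μ] (τ : TracialState A) :
    TracialState (Linfty μ A) :=
  have hint : ∀ f : Linfty μ A, Integrable (fun w => τ (f w)) μ := fun f =>
    (τ.toLinearMap.mkContinuous 1 (fun a => by rw [one_mul]; exact τ.norm_apply_le a)
      ).integrable_comp f.integrable
  { toFun := fun f => ∫ w, τ (f w) ∂μ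
    map_add' := fun f g => by
      rw [← integral_add (hint f) (hint g)]
      refine integral_congr_ae ?_
      filter_upwards [coeFn_add f g] with w h
      rw [h, map_add]
    map_smul' := fun c f => by
      rw [RingHom.id_apply, ← integral_smul]
      refine integral_congr_ae ?_
      filter_upwards [coeFn_smul c f] with w h
      change τ ((c • f : Linfty μ A) w) = _
      rw [h, map_smul]
    map_one' := by
      have : (fun w => τ ((1 : Linfty μ A) w)) =ᵐ[μ] fun _ => (1 : ℂ) := by
        filter_upwards [coeFn_one (μ := μ) (A := A)] with w h
        rw [h, τ.map_one]
      change ∫ w, τ ((1 : Linfty μ A) w) ∂μ = 1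
      rw [integral_congr_ae this]
      simp
    nonneg' := fun f => by
      change 0 ≤ ∫ w, τ ((star f * f : Linfty μ A) w) ∂μ
      refine integral_nonneg_of_ae ?_
      filter_upwards [coeFn_mul (star f) f, coeFn_star f] with w h1 h2
      rw [h1, h2]
      exact τ.nonneg _
    tracial' := fun f g => by
      refine integral_congr_ae ?_
      filter_upwards [coeFn_mul f g, coeFn_mul g f] with w h1 h2
      rw [h1, h2, τ.tracial] }

theorem tracialState_const [IsProbabilityMeasure μ] (τ : TracialState A) (a : A) :
    tracialState μ τ (const μ A a) = τ a := by
  have h : (fun w => τ (const μ A a w)) =ᵐ[μ] fun _ => τ a := by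
    filter_upwards [coeFn_const (μ := μ) a] with w h
    rw [h]
  change ∫ w, τ (const μ A a w) ∂μ = τ a
  rw [integral_congr_ae h]
  simp

end Linfty

/-- The normalized trace `τ_n = (1/n) Tr` on `M_n(ℂ)`. -/
def matrixTrace (n : ℕ) [NeZero n] : TracialState (Matrix (Fin n) (Fin n) ℂ) where
  toLinearMap := ((n : ℂ)⁻¹) • Matrix.traceLinearMap (Fin n) ℂ ℂ
  map_one' := by
    have : (n : ℂ) ≠ 0 := Nat.cast_ne_zero.2 (NeZero.ne n)
    simp [this]
  nonneg' a := by
    have h : 0 ≤ (star a * a).trace := (Matrix.posSemidef_conjTranspose_mul_self a).trace_nonneg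
    have hn : (0 : ℂ) ≤ (n : ℂ)⁻¹ := by
      rw [show ((n : ℂ)⁻¹) = (((n : ℝ)⁻¹ : ℝ) : ℂ) by push_cast; rfl]
      exact Complex.zero_le_real.2 (by positivity)
    exact mul_nonneg hn h
  tracial' a b := congrArg (fun t => (n : ℂ)⁻¹ * t) (Matrix.trace_mul_comm a b)

/-! ### Tracial ultraproducts -/

section Ultraproduct

/-- Norm-bounded sequences `(a_k)` with `a_k ∈ A_k`. -/
def boundedSeq (A : ℕ → Type*) [∀ k, CStarAlgebra (A k)] : StarSubalgebra ℂ (∀ k, A k) where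
  carrier := {a | ∃ C : ℝ, ∀ k, ‖a k‖ ≤ C}
  mul_mem' := by
    rintro a b ⟨C, hC⟩ ⟨D, hD⟩
    exact ⟨C * D, fun k => (norm_mul_le _ _).trans
      (mul_le_mul (hC k) (hD k) (norm_nonneg _) ((norm_nonneg _).trans (hC k)))⟩
  add_mem' := by
    rintro a b ⟨C, hC⟩ ⟨D, hD⟩
    exact ⟨C + D, fun k => (norm_add_le _ _).trans (add_le_add (hC k) (hD k))⟩
  algebraMap_mem' c := ⟨‖c‖ * 1, fun k => by
    rw [Pi.algebraMap_apply, Algebra.algebraMap_eq_smul_one]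
    refine (norm_smul_le _ _).trans (mul_le_mul_of_nonneg_left ?_ (norm_nonneg _))
    rcases subsingleton_or_nontrivial (A k) with h | h
    · rw [Subsingleton.elim (1 : A k) 0, norm_zero]; exact zero_le_one
    · exact CStarRing.norm_one.le⟩
  star_mem' := by
    rintro a ⟨C, hC⟩
    exact ⟨C, fun k => by rw [Pi.star_apply, norm_star]; exact hC k⟩

variable {A : ℕ → Type*} [∀ k, CStarAlgebra (A k)] (τ : ∀ k, TracialState (A k)) (ω : Ultrafilter ℕ)

/-- The two-sided ideal of bounded sequences with `lim_{k → ω} ‖a_k‖₂ = 0`. -/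
def nullIdeal : Ideal (boundedSeq A) where
  carrier := {a | Tendsto (fun k => (τ k).twoNorm (a.1 k)) ω (𝓝 0)}
  add_mem' := by
    intro a b ha hb
    refine squeeze_zero (fun k => (τ k).twoNorm_nonneg _)
      (fun k => (τ k).twoNorm_add_le (a.1 k) (b.1 k)) ?_
    simpa using Tendsto.add ha hb
  zero_mem' := by
    have : (fun k => (τ k).twoNorm ((0 : boundedSeq A).1 k)) = fun _ => 0 := by
      funext k
      simp [TracialState.twoNorm]
    change Tendsto _ _ _
    rw [this]
    exact tendsto_const_nhds
  smul_mem' := by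
    rintro ⟨c, C, hC⟩ a ha
    refine squeeze_zero (fun k => (τ k).twoNorm_nonneg _) (fun k =>
      ((τ k).twoNorm_mul_le (c k) (a.1 k)).trans
        (mul_le_mul_of_nonneg_right (hC k) ((τ k).twoNorm_nonneg _))) ?_
    simpa using Tendsto.const_mul C ha

theorem mem_nullIdeal {a : boundedSeq A} :
    a ∈ nullIdeal τ ω ↔ Tendsto (fun k => (τ k).twoNorm (a.1 k)) ω (𝓝 0) := Iff.rfl

instance : (nullIdeal τ ω).IsTwoSided where
  mul_mem_of_left := by
    rintro a ⟨c, C, hC⟩ ha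
    refine squeeze_zero (fun k => (τ k).twoNorm_nonneg _) (fun k =>
      ((τ k).twoNorm_mul_le' (a.1 k) (c k)).trans
        (mul_le_mul_of_nonneg_left (hC k) ((τ k).twoNorm_nonneg _))) ?_
    simpa using Tendsto.mul_const C ha

/-- The tracial ultraproduct `∏_{k → ω} (A_k, τ_k)`: bounded sequences modulo those with
`lim_{k → ω} ‖a_k‖₂ = 0`. -/
def TracialUltraproduct : Type _ := boundedSeq A ⧸ nullIdeal τ ω

namespace TracialUltraproduct

instance : Ring (TracialUltraproduct τ ω) := inferInstanceAs (Ring (boundedSeq A ⧸ nullIdeal τ ω))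

instance : Algebra ℂ (TracialUltraproduct τ ω) :=
  inferInstanceAs (Algebra ℂ (boundedSeq A ⧸ nullIdeal τ ω))

/-- The quotient map as an algebra homomorphism. -/
def mkAlgHom : boundedSeq A →ₐ[ℂ] TracialUltraproduct τ ω := Ideal.Quotient.mkₐ ℂ (nullIdeal τ ω)

theorem mkAlgHom_surjective : Function.Surjective (mkAlgHom τ ω) :=
  Ideal.Quotient.mkₐ_surjective ℂ (nullIdeal τ ω)

theorem mkAlgHom_eq_iff {a b : boundedSeq A} :
    mkAlgHom τ ω a = mkAlgHom τ ω b ↔ a - b ∈ nullIdeal τ ω :=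
  Ideal.Quotient.mk_eq_mk_iff_sub_mem a b

theorem star_mem_nullIdeal {a : boundedSeq A} (h : a ∈ nullIdeal τ ω) :
    star a ∈ nullIdeal τ ω := by
  rw [mem_nullIdeal] at h ⊢
  refine h.congr fun k => ?_
  exact ((τ k).twoNorm_star (a.1 k)).symm

instance : Star (TracialUltraproduct τ ω) where
  star := Quotient.lift (s := Submodule.quotientRel (nullIdeal τ ω))
    (fun a => mkAlgHom τ ω (star a)) (by
      intro a b h
      have h' : mkAlgHom τ ω a = mkAlgHom τ ω b := Quotient.sound h
      rw [mkAlgHom_eq_iff] at h' ⊢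
      have hs : star a - star b = star (a - b) := Subtype.ext (star_sub a.1 b.1).symm
      rw [hs]
      exact star_mem_nullIdeal τ ω h')

theorem star_mkAlgHom (a : boundedSeq A) :
    star (mkAlgHom τ ω a) = mkAlgHom τ ω (star a) := rfl

instance : StarRing (TracialUltraproduct τ ω) where
  star_involutive u := by
    obtain ⟨a, rfl⟩ := mkAlgHom_surjective τ ω u
    rw [star_mkAlgHom, star_mkAlgHom, star_star]
  star_mul u v := by
    obtain ⟨a, rfl⟩ := mkAlgHom_surjective τ ω u
    obtain ⟨b, rfl⟩ := mkAlgHom_surjective τ ω v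
    rw [← map_mul, star_mkAlgHom, star_mkAlgHom, star_mkAlgHom, star_mul, map_mul]
  star_add u v := by
    obtain ⟨a, rfl⟩ := mkAlgHom_surjective τ ω u
    obtain ⟨b, rfl⟩ := mkAlgHom_surjective τ ω v
    rw [← map_add, star_mkAlgHom, star_mkAlgHom, star_mkAlgHom, star_add, map_add]

instance : StarModule ℂ (TracialUltraproduct τ ω) where
  star_smul c u := by
    obtain ⟨a, rfl⟩ := mkAlgHom_surjective τ ω u
    rw [← map_smul, star_mkAlgHom, star_mkAlgHom, star_smul, map_smul]

/-- The class `[a_k]` of a bounded sequence, as a unital `*`-homomorphism. -/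
def mk : boundedSeq A →⋆ₐ[ℂ] TracialUltraproduct τ ω :=
  { mkAlgHom τ ω with map_star' := fun a => (star_mkAlgHom τ ω a).symm }

theorem mk_surjective : Function.Surjective (mk τ ω) := mkAlgHom_surjective τ ω

theorem mk_eq_iff {a b : boundedSeq A} : mk τ ω a = mk τ ω b ↔
    Tendsto (fun k => (τ k).twoNorm (a.1 k - b.1 k)) ω (𝓝 0) := mkAlgHom_eq_iff τ ω

/-- The limit `lim_{k → ω} τ_k(a_k)`. -/
def limTrace (a : boundedSeq A) : ℂ := limUnder (ω : Filter ℕ) (fun k => τ k (a.1 k))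

theorem tendsto_limTrace (a : boundedSeq A) :
    Tendsto (fun k => τ k (a.1 k)) ω (𝓝 (limTrace τ ω a)) := by
  obtain ⟨C, hC⟩ := a.2
  have hK : IsCompact (Metric.closedBall (0 : ℂ) C) := isCompact_closedBall 0 C
  have hle : ((ω.map (fun k => τ k (a.1 k)) : Ultrafilter ℂ) : Filter ℂ) ≤
      𝓟 (Metric.closedBall (0 : ℂ) C) := by
    refine tendsto_principal.2 (Eventually.of_forall fun k => ?_)
    rw [mem_closedBall_zero_iff]
    exact ((τ k).norm_apply_le _).trans (hC k)
  obtain ⟨z, -, hz⟩ := hK.ultrafilter_le_nhds _ hle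
  exact tendsto_nhds_limUnder ⟨z, hz⟩

theorem limTrace_eq {a : boundedSeq A} {z : ℂ} (h : Tendsto (fun k => τ k (a.1 k)) ω (𝓝 z)) :
    limTrace τ ω a = z := tendsto_nhds_unique (tendsto_limTrace τ ω a) h

theorem limTrace_congr {a b : boundedSeq A} (h : mk τ ω a = mk τ ω b) :
    limTrace τ ω a = limTrace τ ω b := by
  rw [mk_eq_iff] at h
  refine limTrace_eq τ ω ?_
  have h0 : Tendsto (fun k => τ k (a.1 k - b.1 k)) ω (𝓝 0) :=
    squeeze_zero_norm (fun k => (τ k).norm_apply_le_twoNorm _) h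
  have h1 := h0.add (tendsto_limTrace τ ω b)
  rw [zero_add] at h1
  exact h1.congr fun k => by rw [map_sub, sub_add_cancel]

/-- The underlying function of the ultraproduct trace, `[a_k] ↦ lim_{k → ω} τ_k(a_k)`. -/
def traceFn : TracialUltraproduct τ ω → ℂ :=
  Quotient.lift (s := Submodule.quotientRel (nullIdeal τ ω)) (limTrace τ ω)
    (fun _ _ h => limTrace_congr τ ω (Quotient.sound h))

theorem traceFn_mk (a : boundedSeq A) : traceFn τ ω (mk τ ω a) = limTrace τ ω a := rfl

/-- The trace `τ_ω([a_k]) = lim_{k → ω} τ_k(a_k)` on the ultraproduct. -/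
def trace : TracialState (TracialUltraproduct τ ω) where
  toFun := traceFn τ ω
  map_add' u v := by
    obtain ⟨a, rfl⟩ := mk_surjective τ ω u
    obtain ⟨b, rfl⟩ := mk_surjective τ ω v
    rw [← map_add, traceFn_mk, traceFn_mk, traceFn_mk]
    refine limTrace_eq τ ω (((tendsto_limTrace τ ω a).add (tendsto_limTrace τ ω b)).congr
      fun k => ?_)
    exact (map_add _ _ _).symm
  map_smul' c u := by
    obtain ⟨a, rfl⟩ := mk_surjective τ ω u
    rw [← map_smul, traceFn_mk, traceFn_mk]
    refine limTrace_eq τ ω (((tendsto_limTrace τ ω a).const_smul c).congr fun k => ?_)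
    exact (map_smul (τ k).toLinearMap c (a.1 k)).symm
  map_one' := by
    rw [← map_one (mk τ ω)]
    change traceFn τ ω (mk τ ω 1) = 1
    rw [traceFn_mk]
    exact limTrace_eq τ ω (tendsto_const_nhds.congr fun k => (τ k).map_one.symm)
  nonneg' u := by
    obtain ⟨a, rfl⟩ := mk_surjective τ ω u
    rw [← map_star, ← map_mul]
    exact ge_of_tendsto' (tendsto_limTrace τ ω _) fun k => (τ k).nonneg (a.1 k)
  tracial' u v := by
    obtain ⟨a, rfl⟩ := mk_surjective τ ω u
    obtain ⟨b, rfl⟩ := mk_surjective τ ω v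
    rw [← map_mul, ← map_mul]
    exact limTrace_eq τ ω ((tendsto_limTrace τ ω (b * a)).congr fun k =>
      (τ k).tracial (b.1 k) (a.1 k))

variable {B : ℕ → Type*} [∀ k, CStarAlgebra (B k)] (σ : ∀ k, TracialState (B k))

/-- The map `[a_k] ↦ [φ_k(a_k)]` of ultraproducts induced by trace-preserving unital
`*`-homomorphisms `φ_k`. -/
def map (φ : ∀ k, A k →⋆ₐ[ℂ] B k) (hφ : ∀ k a, σ k (φ k a) = τ k a) :
    TracialUltraproduct τ ω →⋆ₐ[ℂ] TracialUltraproduct σ ω :=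
  let ψ : boundedSeq A →⋆ₐ[ℂ] boundedSeq B :=
    { toFun := fun a => ⟨fun k => φ k (a.1 k), by
        obtain ⟨C, hC⟩ := a.2
        exact ⟨C, fun k => (NonUnitalStarAlgHom.norm_apply_le (φ k) (a.1 k)).trans (hC k)⟩⟩
      map_one' := Subtype.ext (funext fun k => map_one (φ k))
      map_mul' := fun a b => Subtype.ext (funext fun k => map_mul (φ k) (a.1 k) (b.1 k))
      map_zero' := Subtype.ext (funext fun k => map_zero (φ k))
      map_add' := fun a b => Subtype.ext (funext fun k => map_add (φ k) (a.1 k) (b.1 k))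
      commutes' := fun c => Subtype.ext (funext fun k => AlgHomClass.commutes (φ k) c)
      map_star' := fun a => Subtype.ext (funext fun k => map_star (φ k) (a.1 k)) }
  { Ideal.Quotient.liftₐ (nullIdeal τ ω) ((mk σ ω).toAlgHom.comp ψ.toAlgHom) (by
      intro a ha
      change mk σ ω (ψ a) = 0
      rw [← map_zero (mk σ ω), mk_eq_iff]
      refine ((mem_nullIdeal τ ω).1 ha).congr fun k => ?_
      change _ = (σ k).twoNorm (φ k (a.1 k) - 0)
      rw [sub_zero, TracialState.twoNorm, TracialState.twoNorm, ← map_star, ← map_mul, hφ]) with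
    map_star' := fun u => by
      obtain ⟨a, rfl⟩ := mk_surjective τ ω u
      change mk σ ω (ψ (star a)) = star (mk σ ω (ψ a))
      rw [map_star, map_star] }

theorem map_mk (φ : ∀ k, A k →⋆ₐ[ℂ] B k) (hφ : ∀ k a, σ k (φ k a) = τ k a) (a : ∀ k, A k)
    (ha : a ∈ boundedSeq A) (hb : (fun k => φ k (a k)) ∈ boundedSeq B) :
    map τ ω σ φ hφ (mk τ ω ⟨a, ha⟩) = mk σ ω ⟨fun k => φ k (a k), hb⟩ := rfl

end TracialUltraproduct

end Ultraproduct

/-! ### Conditional expectations and von Neumann algebras -/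

/-- `E : A → B` is the trace-preserving conditional expectation for the inclusion `ι : B → A` of
unital `*`-algebras and the tracial state `τ` on `A`: a linear `B`-bimodule projection onto `B`
that preserves the trace. When `τ` is faithful these conditions determine `E` uniquely, since
`τ (ι (E a) * ι b) = τ (a * ι b)` for all `b`; positivity of `E` follows from them for the
operator algebras considered here. -/
structure IsTracialCondExp {A B : Type*} [Ring A] [StarRing A] [Algebra ℂ A]
    [Ring B] [StarRing B] [Algebra ℂ B] (τ : TracialState A) (ι : B →⋆ₐ[ℂ] A) (E : A →ₗ[ℂ] B) :
    Prop where
  map_incl : ∀ b : B, E (ι b) = b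
  map_bimodule : ∀ (b : B) (a : A) (c : B), E (ι b * a * ι c) = b * E a * c
  trace_preserving : ∀ a : A, τ (ι (E a)) = τ a

section VonNeumann

variable {H : Type*} [NormedAddCommGroup H] [InnerProductSpace ℂ H] [CompleteSpace H]

/-- `τ` is normal, i.e. ultraweakly continuous: it has the form `a ↦ ∑ j, ⟪ξ j, a (η j)⟫` with
`∑ j, ‖ξ j‖ ^ 2 < ∞` and `∑ j, ‖η j‖ ^ 2 < ∞`. -/
def IsNormalState (M : VonNeumannAlgebra H) (τ : TracialState M.toStarSubalgebra) : Prop :=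
  ∃ ξ η : ℕ → H, Summable (fun j => ‖ξ j‖ ^ 2) ∧ Summable (fun j => ‖η j‖ ^ 2) ∧
    ∀ a : M.toStarSubalgebra, HasSum (fun j => inner ℂ (ξ j) ((a : H →L[ℂ] H) (η j))) (τ a)

/-- The elements `x i` of `M` generate `M` as a von Neumann algebra: `M` is the smallest von
Neumann algebra that contains all of them. -/
def GeneratedBy (M : VonNeumannAlgebra H) {I : Type*} (x : I → M.toStarSubalgebra) : Prop :=
  ∀ N : VonNeumannAlgebra H, (∀ i, (x i : H →L[ℂ] H) ∈ N) → M ≤ N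

/-- The inclusion `P → M` of a von Neumann subalgebra. -/
def vnInclusion {P M : VonNeumannAlgebra H} (h : P ≤ M) :
    P.toStarSubalgebra →⋆ₐ[ℂ] M.toStarSubalgebra :=
  StarSubalgebra.inclusion (S₁ := P.toStarSubalgebra) (S₂ := M.toStarSubalgebra) h

end VonNeumann

/-! ### Matrix ultraproducts and random matrix models -/

section Models

/-- The deterministic matrix ultraproduct `∏_{k → ω} M_{n(k)}(ℂ)`. -/
abbrev MatrixUltraproduct (n : ℕ → ℕ) [∀ k, NeZero (n k)] (ω : Ultrafilter ℕ) : Type _ :=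
  TracialUltraproduct (fun k => matrixTrace (n k)) ω

/-- The random matrix ultraproduct `∏_{k → ω} L^∞(Ω, M_{n(k)}(ℂ))`, with respect to the traces
`f ↦ ∫ τ_{n(k)}(f) dμ`. -/
abbrev RandomMatrixUltraproduct (n : ℕ → ℕ) [∀ k, NeZero (n k)] {Ω : Type*} [MeasurableSpace Ω]
    (μ : Measure Ω) [IsProbabilityMeasure μ] (ω : Ultrafilter ℕ) : Type _ :=
  TracialUltraproduct (fun k => Linfty.tracialState μ (matrixTrace (n k))) ω

variable (n : ℕ → ℕ) [∀ k, NeZero (n k)] {Ω : Type*} [MeasurableSpace Ω] (μ : Measure Ω)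
  [IsProbabilityMeasure μ] (ω : Ultrafilter ℕ)

/-- The trace `τ_ω` on the random matrix ultraproduct. -/
def randomTrace : TracialState (RandomMatrixUltraproduct n μ ω) :=
  TracialUltraproduct.trace _ ω

/-- The inclusion `ι_ω` of the deterministic into the random matrix ultraproduct, induced by the
inclusions of `M_{n(k)}(ℂ)` into `L^∞(Ω, M_{n(k)}(ℂ))` as constant functions. -/
def deterministicInclusion : MatrixUltraproduct n ω →⋆ₐ[ℂ] RandomMatrixUltraproduct n μ ω :=
  TracialUltraproduct.map _ ω _ (fun k => Linfty.const μ (Matrix (Fin (n k)) (Fin (n k)) ℂ))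
    (fun k a => Linfty.tracialState_const (matrixTrace (n k)) a)

variable {n μ}
variable {I : Type*} {X : ∀ k, I → Ω → Matrix (Fin (n k)) (Fin (n k)) ℂ}

/-- The element `y i` of the random matrix ultraproduct that is represented by the sequence of
random matrices `(X k i)`, for almost surely uniformly bounded `X`. -/
def modelElement (hX : ∀ k i, AEStronglyMeasurable (X k i) μ) {R : I → ℝ}
    (hb : ∀ k i, ∀ᵐ w ∂μ, ‖X k i w‖ ≤ R i) (i : I) : RandomMatrixUltraproduct n μ ω :=
  TracialUltraproduct.mk _ ω ⟨fun k => Linfty.ofBounded (X k i) (hX k i) ⟨R i, hb k i⟩, |R i|,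
    fun k => Linfty.norm_le (abs_nonneg _) (by
      filter_upwards [hb k i, Linfty.coeFn_ofBounded (X k i) (hX k i) ⟨R i, hb k i⟩] with w h1 h2
      rw [h2]
      exact h1.trans (le_abs_self _))⟩

/-- `ρ : A → ∏_{k → ω} L^∞(Ω, M_{n(k)}(ℂ))` is the trace-preserving embedding with
`ρ (x i) = y i`. -/
structure IsInducedEmbedding {A : Type*} [Ring A] [StarRing A] [Algebra ℂ A] (τ : TracialState A)
    (x : I → A) (y : I → RandomMatrixUltraproduct n μ ω)
    (ρ : A →⋆ₐ[ℂ] RandomMatrixUltraproduct n μ ω) : Prop where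
  trace_preserving : ∀ a : A, randomTrace n μ ω (ρ a) = τ a
  map_generator : ∀ i, ρ (x i) = y i

/-- Convergence of the non-commutative laws of `X k` to that of `x` in probability:
`τ_{n(k)}(p(X k)) → τ(p(x))` in probability for every non-commutative polynomial `p`. -/
def ConvergesInLaw {A : Type*} [Ring A] [StarRing A] [Algebra ℂ A] (τ : TracialState A)
    (x : I → A) (μ : Measure Ω) (X : ∀ k, I → Ω → Matrix (Fin (n k)) (Fin (n k)) ℂ) : Prop :=
  ∀ p : FreeAlgebra ℂ I, TendstoInMeasure μ
    (fun k w => matrixTrace (n k) (FreeAlgebra.lift ℂ (fun i => X k i w) p)) atTop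
    (fun _ => τ (FreeAlgebra.lift ℂ x p))

/-- The external averaging property: `‖𝔼[p(X k)]‖₂ → ‖E[p(x)]‖₂` as `k → ∞` for every
non-commutative polynomial `p`, where `E : A → B` is a conditional expectation for the inclusion
`ι : B → A`. -/
def ExternalAveragingProperty {A B : Type*} [Ring A] [StarRing A] [Algebra ℂ A]
    [Ring B] [StarRing B] [Algebra ℂ B] (τ : TracialState A) (x : I → A) (ι : B →⋆ₐ[ℂ] A)
    (E : A →ₗ[ℂ] B) (μ : Measure Ω) (X : ∀ k, I → Ω → Matrix (Fin (n k)) (Fin (n k)) ℂ) : Prop :=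
  ∀ p : FreeAlgebra ℂ I, Tendsto
    (fun k => (matrixTrace (n k)).twoNorm (∫ w, FreeAlgebra.lift ℂ (fun i => X k i w) p ∂μ))
    atTop (𝓝 (τ.twoNorm (ι (E (FreeAlgebra.lift ℂ x p)))))

end Models

end

/-!
Everything is measured in the `L²`-norms. Truncating a self-adjoint element by functional calculus
does not increase its `2`-norm distance to self-adjoint elements of small norm, so `2`-norm
approximations can be chosen with controlled operator norm, as in Kaplansky's density theorem. In
an algebra whose norm balls are `2`-norm complete this provides orthogonal projections onto
subalgebras, hence conditional expectations, and it extends trace-preserving homomorphisms from the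
`*`-algebra of the generators, hence provides `ρ_ω`.

The expectation `E_ω` is induced by the expectations `𝔼`, so `lim_{k → ω} ‖𝔼[p(X k)]‖₂` is
`‖ι_ω E_ω ρ_ω p(x)‖₂`. Therefore the external averaging property says that `ι_ω E_ω ρ_ω` and
`ρ_ω E_P` have equal `2`-norms at every element of `M`. Both conditional expectations are orthogonal
projections, and by Pythagoras equality of these norms forces `ι_ω E_ω ρ_ω = ρ_ω E_P`; the
description of `ρ_ω(P)` follows.
-/

noncomputable section

/-! ### The Hilbert space of a tracial state -/

namespace TracialState

section Hilbert

variable {A : Type*} [Ring A] [StarRing A] [Algebra ℂ A]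

theorem ofReal_twoNorm_sq (τ : TracialState A) (a : A) :
    ((τ.twoNorm a ^ 2 : ℝ) : ℂ) = τ (star a * a) := by
  have h := τ.nonneg a
  rw [twoNorm, Real.sq_sqrt (Complex.le_def.1 h).1]
  exact Complex.ext rfl (Complex.le_def.1 h).2

theorem twoNorm_zero (τ : TracialState A) : τ.twoNorm 0 = 0 := by
  simp [twoNorm]

theorem IsFaithful.eq_of_orthogonal {B : Type*} [Ring B] [StarRing B] [Algebra ℂ B]
    {τ : TracialState A} (hτ : τ.IsFaithful) {ι : B →⋆ₐ[ℂ] A} (hι : Function.Injective ι) {a : A}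
    {b b' : B} (hb : ∀ c : B, τ (star (ι c) * (a - ι b)) = 0)
    (hb' : ∀ c : B, τ (star (ι c) * (a - ι b')) = 0) : b = b' := by
  refine hι (sub_eq_zero.1 (hτ _ ?_))
  rw [← map_sub ι]
  calc τ (star (ι (b - b')) * ι (b - b'))
      = τ (star (ι (b - b')) * (a - ι b')) - τ (star (ι (b - b')) * (a - ι b)) := by
        rw [← map_sub, ← mul_sub, sub_sub_sub_cancel_left, ← map_sub ι]
    _ = 0 := by rw [hb, hb', sub_zero]

theorem twoNorm_map {B : Type*} [Ring B] [StarRing B] [Algebra ℂ B] {τ : TracialState A}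
    {σ : TracialState B} {φ : A →⋆ₐ[ℂ] B} (hφ : ∀ a, σ (φ a) = τ a) (a : A) :
    σ.twoNorm (φ a) = τ.twoNorm a := by
  rw [twoNorm, twoNorm, ← map_star, ← map_mul, hφ]

theorem IsFaithful.eq_of_twoNorm_sub_eq_zero {τ : TracialState A} (hτ : τ.IsFaithful) {a b : A}
    (h : τ.twoNorm (a - b) = 0) : a = b := by
  refine sub_eq_zero.1 (hτ _ ?_)
  rw [← ofReal_twoNorm_sq, h]
  simp

theorem IsFaithful.injective {B : Type*} [Ring B] [StarRing B] [Algebra ℂ B] {τ : TracialState A}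
    (hτ : τ.IsFaithful) {σ : TracialState B} {φ : A →⋆ₐ[ℂ] B} (hφ : ∀ a, σ (φ a) = τ a) :
    Function.Injective φ := fun a b h => by
  refine hτ.eq_of_twoNorm_sub_eq_zero ?_
  rw [← twoNorm_map hφ, map_sub, h, sub_self, twoNorm_zero]

theorem im_apply_add_star (τ : TracialState A) (a : A) : (τ (a + star a)).im = 0 := by
  have h := (Complex.le_def.1 (τ.nonneg (1 + a))).2
  have h₀ := (Complex.le_def.1 (τ.nonneg a)).2
  have expand : star (1 + a) * (1 + a) = 1 + (a + star a) + star a * a := by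
    rw [star_add, star_one]
    noncomm_ring
  rw [expand, map_add, map_add _ 1, τ.map_one] at h
  simp only [Complex.add_im, Complex.one_im, Complex.zero_im] at h h₀
  linarith

variable [StarModule ℂ A] (τ : TracialState A)

theorem apply_star (a : A) : τ (star a) = star (τ a) := by
  have him := τ.im_apply_add_star a
  have hre := τ.im_apply_add_star (Complex.I • a)
  simp only [star_smul, map_add, map_smul, smul_eq_mul, Complex.add_im, Complex.mul_im,
    Complex.star_def, Complex.conj_I, Complex.I_re, Complex.I_im, Complex.neg_re,
    Complex.neg_im] at him hre
  apply Complex.ext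
  · rw [Complex.star_def, Complex.conj_re]
    linarith
  · rw [Complex.star_def, Complex.conj_im]
    linarith

/-- The underlying vector space of `A`, regarded as a pre-Hilbert space for the semi-inner product
`⟪a, b⟫ = τ (a* b)`; the type synonym keeps this structure apart from the norm of `A`. -/
@[nolint unusedArguments]
def PreL2 (_ : TracialState A) : Type _ := A

instance : AddCommGroup τ.PreL2 := inferInstanceAs (AddCommGroup A)
instance : Module ℂ τ.PreL2 := inferInstanceAs (Module ℂ A)

/-- The identity map from `A` to the synonym `PreL2`. -/
def toPreL2 : A →ₗ[ℂ] τ.PreL2 := LinearMap.id (M := A)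

/-- The semi-inner product `⟪a, b⟫ = τ (a* b)`. -/
@[reducible]
def preCore : PreInnerProductSpace.Core ℂ τ.PreL2 where
  inner a b := τ (star (show A from a) * (show A from b))
  conj_inner_symm a b := by
    change star (τ (star (show A from b) * (show A from a))) = _
    rw [← τ.apply_star, star_mul, star_star]
  re_inner_nonneg a := (Complex.le_def.1 (τ.nonneg (show A from a))).1
  add_left a b c := by
    change τ (star ((show A from a) + (show A from b)) * (show A from c)) = _
    rw [star_add, add_mul, map_add]
  smul_left a b r := by
    change τ (star (r • (show A from a)) * (show A from b)) = _
    rw [star_smul, smul_mul_assoc, map_smul]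
    rfl

instance : SeminormedAddCommGroup τ.PreL2 :=
  InnerProductSpace.Core.toSeminormedAddCommGroup (c := τ.preCore)
instance : InnerProductSpace ℂ τ.PreL2 := InnerProductSpace.ofCore τ.preCore

/-- The Hilbert space `L²(A, τ)`, the completion of `A` in the `2`-norm. -/
abbrev L2 : Type _ := UniformSpace.Completion τ.PreL2

/-- The canonical map `A → L²(A, τ)`. Convergence in `2`-norm is expressed as convergence of the
images under this map. -/
def toL2 : A →ₗ[ℂ] τ.L2 :=
  (UniformSpace.Completion.toComplₗᵢ (𝕜 := ℂ) (E := τ.PreL2)).toLinearMap ∘ₗ τ.toPreL2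

theorem denseRange_toL2 : DenseRange τ.toL2 :=
  UniformSpace.Completion.denseRange_coe (α := τ.PreL2)

theorem inner_toL2 (a b : A) : inner ℂ (τ.toL2 a) (τ.toL2 b) = τ (star a * b) :=
  UniformSpace.Completion.inner_coe (𝕜 := ℂ) (E := τ.PreL2) _ _

theorem norm_toL2 (a : A) : ‖τ.toL2 a‖ = τ.twoNorm a := by
  rw [@norm_eq_sqrt_re_inner ℂ, inner_toL2]
  rfl

theorem twoNorm_sub_comm (a b : A) : τ.twoNorm (a - b) = τ.twoNorm (b - a) := by
  rw [← norm_toL2, ← norm_toL2, map_sub, map_sub, norm_sub_rev]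

theorem twoNorm_smul (c : ℂ) (a : A) : τ.twoNorm (c • a) = ‖c‖ * τ.twoNorm a := by
  rw [← norm_toL2, ← norm_toL2, map_smul, norm_smul]

theorem abs_twoNorm_sub_le (a b : A) : |τ.twoNorm a - τ.twoNorm b| ≤ τ.twoNorm (a - b) := by
  rw [← norm_toL2, ← norm_toL2, ← norm_toL2, map_sub]
  exact abs_norm_sub_norm_le _ _

theorem twoNorm_sq_eq_add_of_orthogonal {a b : A} (h : τ (star b * (a - b)) = 0) :
    τ.twoNorm a ^ 2 = τ.twoNorm b ^ 2 + τ.twoNorm (a - b) ^ 2 := by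
  rw [← norm_toL2, ← norm_toL2, ← norm_toL2, sq, sq, sq,
    ← norm_add_sq_eq_norm_sq_add_norm_sq_of_inner_eq_zero (𝕜 := ℂ) _ _ (by rw [inner_toL2, h]),
    ← map_add, add_sub_cancel]

theorem tendsto_toL2_iff {α : Type*} {l : Filter α} {u : α → A} {a : A} :
    Tendsto (fun j => τ.toL2 (u j)) l (𝓝 (τ.toL2 a)) ↔
      Tendsto (fun j => τ.twoNorm (u j - a)) l (𝓝 0) := by
  rw [tendsto_iff_norm_sub_tendsto_zero]
  simp_rw [← map_sub, norm_toL2]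

end Hilbert

end TracialState

/-! ### Trace-preserving conditional expectations -/

namespace IsTracialCondExp

variable {A B : Type*} [Ring A] [StarRing A] [Algebra ℂ A]
  [Ring B] [StarRing B] [Algebra ℂ B] {τ : TracialState A} {ι : B →⋆ₐ[ℂ] A} {E : A →ₗ[ℂ] B}

theorem map_incl_mul (hE : IsTracialCondExp τ ι E) (b : B) (a : A) : E (ι b * a) = b * E a := by
  simpa using hE.map_bimodule b a 1

theorem apply_incl_star_mul_sub (hE : IsTracialCondExp τ ι E) (b : B) (a : A) :
    τ (star (ι b) * (a - ι (E a))) = 0 := by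
  rw [← map_star ι, mul_sub, map_sub, ← hE.trace_preserving (ι (star b) * a), hE.map_incl_mul,
    map_mul ι, sub_self]

theorem unique (hτ : τ.IsFaithful) (hι : Function.Injective ι) {E' : A →ₗ[ℂ] B}
    (hE : IsTracialCondExp τ ι E) (hE' : IsTracialCondExp τ ι E') : E = E' :=
  LinearMap.ext fun a => hτ.eq_of_orthogonal hι (fun c => hE.apply_incl_star_mul_sub c a)
    fun c => hE'.apply_incl_star_mul_sub c a

theorem exists_of_orthogonal (hτ : τ.IsFaithful) (hι : Function.Injective ι)
    (h : ∀ a, ∃ b : B, ∀ c : B, τ (star (ι c) * (a - ι b)) = 0) :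
    ∃ E : A →ₗ[ℂ] B, IsTracialCondExp τ ι E := by
  choose e he using h
  have e_eq {a b} (hb : ∀ c : B, τ (star (ι c) * (a - ι b)) = 0) : e a = b :=
    hτ.eq_of_orthogonal hι (he a) hb
  refine ⟨⟨⟨e, fun a b => e_eq fun c => ?_⟩, fun r a => e_eq fun c => ?_⟩,
    ⟨fun b => e_eq fun c => ?_, fun b a c => e_eq fun d => ?_, fun a => ?_⟩⟩
  · rw [map_add, add_sub_add_comm, mul_add, map_add, he, he, add_zero]
  · rw [RingHom.id_apply, map_smul, ← smul_sub, mul_smul_comm, map_smul, he, smul_zero]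
  · rw [sub_self, mul_zero, map_zero]
  · have := he a (star b * d * star c)
    simp only [map_mul ι, star_mul, map_star ι, star_star] at this
    change τ (star (ι d) * (ι b * a * ι c - ι (b * e a * c))) = 0
    rw [map_mul ι, map_mul ι, ← sub_mul, ← mul_sub, ← mul_assoc, τ.tracial]
    simpa only [mul_assoc] using this
  · have := he a 1
    rw [map_one, star_one, one_mul, map_sub, sub_eq_zero] at this
    exact this.symm

section Pythagoras

variable [StarModule ℂ A]

theorem twoNorm_sq_eq_add (hE : IsTracialCondExp τ ι E) (a : A) :
    τ.twoNorm a ^ 2 = τ.twoNorm (ι (E a)) ^ 2 + τ.twoNorm (a - ι (E a)) ^ 2 :=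
  τ.twoNorm_sq_eq_add_of_orthogonal (hE.apply_incl_star_mul_sub _ _)

theorem twoNorm_incl_apply_le (hE : IsTracialCondExp τ ι E) (a : A) :
    τ.twoNorm (ι (E a)) ≤ τ.twoNorm a := by
  refine le_of_sq_le_sq ?_ (τ.twoNorm_nonneg a)
  rw [hE.twoNorm_sq_eq_add a]
  exact le_add_of_nonneg_right (sq_nonneg _)

theorem incl_apply_eq_of_twoNorm_eq (hE : IsTracialCondExp τ ι E) (hτ : τ.IsFaithful) {a : A}
    (h : τ.twoNorm (ι (E a)) = τ.twoNorm a) : ι (E a) = a := by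
  refine (hτ.eq_of_twoNorm_sub_eq_zero ?_).symm
  have := hE.twoNorm_sq_eq_add a
  rw [h] at this
  exact pow_eq_zero_iff two_ne_zero |>.1 (by linarith)

end Pythagoras

/-- By Pythagoras, equality of the `2`-norms of the two expectations forces `F` to fix `ρ (ι b)` and
to kill `ρ (z - ι (E z))`. -/
theorem intertwines_of_twoNorm_eq {U D : Type*} [Ring U] [StarRing U] [Algebra ℂ U]
    [StarModule ℂ U] [Ring D] [StarRing D] [Algebra ℂ D] {σ : TracialState U} {j : D →⋆ₐ[ℂ] U}
    {F : U →ₗ[ℂ] D} {ρ : A →⋆ₐ[ℂ] U} (hE : IsTracialCondExp τ ι E)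
    (hF : IsTracialCondExp σ j F) (hσ : σ.IsFaithful) (hρ : ∀ a, σ (ρ a) = τ a)
    (h : ∀ z, σ.twoNorm (j (F (ρ z))) = τ.twoNorm (ι (E z))) (z : A) :
    j (F (ρ z)) = ρ (ι (E z)) := by
  have fixes : j (F (ρ (ι (E z)))) = ρ (ι (E z)) := hF.incl_apply_eq_of_twoNorm_eq hσ (by
    rw [h, hE.map_incl, TracialState.twoNorm_map hρ])
  have kills : j (F (ρ (z - ι (E z)))) = 0 := hσ.eq_of_twoNorm_sub_eq_zero (by
    rw [sub_zero, h, map_sub, hE.map_incl, sub_self, map_zero, τ.twoNorm_zero])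
  rwa [map_sub, map_sub, map_sub, fixes, sub_eq_zero] at kills

theorem image_range_eq_of_intertwines {U D : Type*} [Ring U] [StarRing U] [Algebra ℂ U]
    [Ring D] [StarRing D] [Algebra ℂ D] {σ : TracialState U} {j : D →⋆ₐ[ℂ] U} {F : U →ₗ[ℂ] D}
    {ρ : A →⋆ₐ[ℂ] U} (hE : IsTracialCondExp τ ι E) (hF : IsTracialCondExp σ j F)
    (h : ∀ z, j (F (ρ z)) = ρ (ι (E z))) : ρ '' Set.range ι = Set.range ρ ∩ Set.range j := by
  refine Set.Subset.antisymm ?_ ?_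
  · rintro _ ⟨_, ⟨b, rfl⟩, rfl⟩
    exact ⟨⟨_, rfl⟩, F (ρ (ι b)), by rw [h, hE.map_incl]⟩
  · rintro _ ⟨⟨z, rfl⟩, d, hd⟩
    exact ⟨_, ⟨E z, rfl⟩, by rw [← h, ← hd, hF.map_incl]⟩

end IsTracialCondExp

/-! ### Truncation by functional calculus -/

/-- The truncation of the real line to the interval `[-C, C]`. -/
def clamp (C t : ℝ) : ℝ := max (-C) (min t C)

theorem continuous_clamp (C : ℝ) : Continuous (clamp C) := by
  unfold clamp
  fun_prop

theorem abs_clamp_le {C : ℝ} (hC : 0 ≤ C) (t : ℝ) : |clamp C t| ≤ C :=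
  abs_le.2 ⟨le_max_left _ _, max_le (by linarith) (min_le_right _ _)⟩

theorem clamp_cases {C : ℝ} (hC : 0 ≤ C) (t : ℝ) :
    clamp C t = C ∧ C ≤ t ∨ clamp C t = -C ∧ t ≤ -C ∨ clamp C t = t ∧ -C ≤ t ∧ t ≤ C := by
  unfold clamp
  grind

/-- With `c` the truncation of `b`, one has `c - b = Q - P` for positive `P`, `Q` supported where
`c` is `C`, respectively `-C`. -/
theorem sub_clamp_mul_eq {A : Type*} [CStarAlgebra A] (a : A) {b : A} (hb : IsSelfAdjoint b)
    {C : ℝ} (hC : 0 ≤ C) :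
    (a - cfc (clamp C) b) * (cfc (clamp C) b - b) =
      (algebraMap ℝ A C - a) * cfc (fun t => max (t - C) 0) b +
        (a + algebraMap ℝ A C) * cfc (fun t => max (-C - t) 0) b := by
  set p : ℝ → ℝ := fun t => max (t - C) 0
  set q : ℝ → ℝ := fun t => max (-C - t) 0
  have _ : Continuous p := by fun_prop
  have _ : Continuous q := by fun_prop
  have hc : Continuous (clamp C) := continuous_clamp C
  have clamp_sub (t : ℝ) : clamp C t - t = q t - p t := by
    rcases clamp_cases hC t with h | h | h <;> grind
  have clamp_mul_p (t : ℝ) : clamp C t * p t = C * p t := by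
    rcases clamp_cases hC t with h | h | h <;> grind
  have clamp_mul_q (t : ℝ) : clamp C t * q t = -C * q t := by
    rcases clamp_cases hC t with h | h | h <;> grind
  have sub_eq : cfc (clamp C) b - b = cfc q b - cfc p b := by
    calc cfc (clamp C) b - b = cfc (clamp C) b - cfc (fun t => t) b := by rw [cfc_id' ℝ b]
      _ = cfc q b - cfc p b := by
        rw [← cfc_sub (clamp C) (fun t => t) b, ← cfc_sub q p b]
        simp only [clamp_sub]
  have mul_p : cfc (clamp C) b * cfc p b = C • cfc p b := by
    rw [← cfc_mul (clamp C) p b, ← cfc_const_mul C p b]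
    simp only [clamp_mul_p]
  have mul_q : cfc (clamp C) b * cfc q b = -C • cfc q b := by
    rw [← cfc_mul (clamp C) q b, ← cfc_const_mul (-C) q b]
    simp only [clamp_mul_q]
  rw [sub_eq, mul_sub, sub_mul, sub_mul, mul_p, mul_q, sub_mul, add_mul,
    ← Algebra.smul_def, ← Algebra.smul_def, neg_smul]
  abel

namespace TracialState

variable {A : Type*} [CStarAlgebra A] (τ : TracialState A)

theorem apply_mul_nonneg [PartialOrder A] [StarOrderedRing A] {a b : A} (ha : 0 ≤ a)
    (hb : 0 ≤ b) : 0 ≤ τ (a * b) := by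
  obtain ⟨s, rfl⟩ := CStarAlgebra.nonneg_iff_eq_star_mul_self.1 hb
  obtain ⟨c, hc⟩ := CStarAlgebra.nonneg_iff_eq_star_mul_self.1 (star_right_conjugate_nonneg ha s)
  rw [← mul_assoc, τ.tracial, ← mul_assoc, hc]
  exact τ.nonneg c

theorem re_apply_sub_clamp_mul_nonneg {a b : A} (ha : IsSelfAdjoint a) (hb : IsSelfAdjoint b)
    {C : ℝ} (hC : ‖a‖ ≤ C) :
    0 ≤ (τ ((a - cfc (clamp C) b) * (cfc (clamp C) b - b))).re := by
  let _ := CStarAlgebra.spectralOrder A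
  have _ := CStarAlgebra.spectralOrderedRing A
  have hC₀ : 0 ≤ C := (norm_nonneg a).trans hC
  have norm_le_C : algebraMap ℝ A ‖a‖ ≤ algebraMap ℝ A C := algebraMap_mono A hC
  have le_C : a ≤ algebraMap ℝ A C := ha.le_algebraMap_norm_self.trans norm_le_C
  have neg_C_le : -algebraMap ℝ A C ≤ a :=
    (neg_le_neg norm_le_C).trans ha.neg_algebraMap_norm_le_self
  rw [sub_clamp_mul_eq a hb hC₀, map_add]
  refine (Complex.le_def.1 (add_nonneg (τ.apply_mul_nonneg (sub_nonneg.2 le_C) ?_)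
    (τ.apply_mul_nonneg (neg_le_iff_add_nonneg.1 neg_C_le) ?_))).1
  · exact cfc_nonneg fun t _ => le_max_right _ _
  · exact cfc_nonneg fun t _ => le_max_right _ _

theorem twoNorm_sub_clamp_le {a b : A} (ha : IsSelfAdjoint a) (hb : IsSelfAdjoint b) {C : ℝ}
    (hC : ‖a‖ ≤ C) : τ.twoNorm (a - cfc (clamp C) b) ≤ τ.twoNorm (a - b) := by
  have hc : IsSelfAdjoint (cfc (clamp C) b) := cfc_predicate (clamp C) b
  have hre : 0 ≤ RCLike.re (inner ℂ (τ.toL2 (a - cfc (clamp C) b))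
      (τ.toL2 (cfc (clamp C) b - b))) := by
    rw [inner_toL2, (ha.sub hc).star_eq]
    exact τ.re_apply_sub_clamp_mul_nonneg ha hb hC
  refine le_of_sq_le_sq ?_ (τ.twoNorm_nonneg _)
  rw [← sub_add_sub_cancel a (cfc (clamp C) b) b, ← norm_toL2, ← norm_toL2, map_add,
    @norm_add_sq ℂ]
  linarith [sq_nonneg ‖τ.toL2 (cfc (clamp C) b - b)‖]

theorem twoNorm_realPart_le (a : A) : τ.twoNorm (realPart a : A) ≤ τ.twoNorm a := by
  have h := τ.twoNorm_add_le a (star a)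
  rw [twoNorm_star] at h
  rw [realPart_apply_coe, ← Complex.coe_smul, twoNorm_smul]
  norm_num
  linarith

/-- Take the real part of `g` and truncate it. -/
theorem exists_mem_norm_le_twoNorm_sub_le {X : Type*} [CStarAlgebra X] {G : StarSubalgebra ℂ X}
    (hG : IsClosed (G : Set X)) (φ : X →⋆ₐ[ℂ] A) {a : A} (ha : IsSelfAdjoint a) {g : X}
    (hg : g ∈ G) : ∃ k ∈ G, ‖k‖ ≤ ‖a‖ ∧ τ.twoNorm (a - φ k) ≤ τ.twoNorm (a - φ g) := by
  have hre : (realPart g : X) ∈ G := by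
    rw [realPart_apply_coe, ← Complex.coe_smul]
    exact G.smul_mem (add_mem hg (star_mem hg)) _
  have hφ : φ (cfc (clamp ‖a‖) (realPart g : X)) = cfc (clamp ‖a‖) (realPart (φ g) : A) := by
    rw [← map_realPart]
    exact StarAlgHomClass.map_cfc (S := ℂ) φ (clamp ‖a‖) _
      (hf := (continuous_clamp ‖a‖).continuousOn)
      (hφ := (NonUnitalStarAlgHom.instContinuousLinearMapClassComplex (F := X →⋆ₐ[ℂ] A)
        ).map_continuous φ) (ha := (realPart g).2) (hφa := (realPart g).2.map φ)
  refine ⟨cfc (clamp ‖a‖) (realPart g : X), cfc_mem (hs := hG) (𝕜' := ℂ) _ hre,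
    norm_cfc_le (norm_nonneg a) fun t _ => abs_clamp_le (norm_nonneg a) t, ?_⟩
  calc τ.twoNorm (a - φ (cfc (clamp ‖a‖) (realPart g : X)))
      ≤ τ.twoNorm (a - (realPart (φ g) : A)) := by
        rw [hφ]
        exact τ.twoNorm_sub_clamp_le ha (realPart (φ g)).2 le_rfl
    _ = τ.twoNorm (realPart (a - φ g) : A) := by
        rw [map_sub, AddSubgroupClass.coe_sub, ha.coe_realPart]
    _ ≤ τ.twoNorm (a - φ g) := τ.twoNorm_realPart_le _

end TracialState

/-! ### Complete balls and orthogonal projections -/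

theorem norm_starProjection_sub_le_of_norm_sub_le {H : Type*} [NormedAddCommGroup H]
    [InnerProductSpace ℂ H] {K : Submodule ℂ H} [K.HasOrthogonalProjection] {v x y : H}
    (hx : x ∈ K) (hy : y ∈ K) (h : ‖v - x‖ ≤ ‖v - y‖) :
    ‖K.starProjection v - x‖ ≤ ‖K.starProjection v - y‖ := by
  have pythagoras {z : H} (hz : z ∈ K) :
      ‖v - z‖ ^ 2 = ‖v - K.starProjection v‖ ^ 2 + ‖K.starProjection v - z‖ ^ 2 := by
    have orthogonal : inner ℂ (v - K.starProjection v) (K.starProjection v - z) = 0 :=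
      (Submodule.mem_orthogonal' _ _).1 (Submodule.sub_starProjection_mem_orthogonal v) _
        (K.sub_mem (Submodule.starProjection_apply_mem _ _) hz)
    rw [sq, sq, sq, ← norm_add_sq_eq_norm_sq_add_norm_sq_of_inner_eq_zero _ _ orthogonal,
      sub_add_sub_cancel]
  refine le_of_sq_le_sq ?_ (norm_nonneg _)
  linarith [pythagoras hx, pythagoras hy, pow_le_pow_left₀ (norm_nonneg _) h 2]

namespace TracialState

variable {A : Type*} [CStarAlgebra A]

/-- Norm-bounded sequences in `S` that are Cauchy in `2`-norm converge in `2`-norm to an element of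
`S`. For `S` the whole algebra and `τ` faithful this says that `A` is a von Neumann algebra in its
GNS representation, and it is the only form in which weak closedness is used. -/
def BallComplete (τ : TracialState A) (S : Set A) : Prop :=
  ∀ (u : ℕ → A) (C : ℝ), (∀ j, u j ∈ S) → (∀ j, ‖u j‖ ≤ C) → CauchySeq (fun j => τ.toL2 (u j)) →
    ∃ v ∈ S, Tendsto (fun j => τ.toL2 (u j)) atTop (𝓝 (τ.toL2 v))

variable {τ : TracialState A} {B : StarSubalgebra ℂ A}

/-- Elements of `B` approximating the projection of `a` in `L²` may be truncated at `‖a‖`. -/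
theorem exists_orthogonal_of_isSelfAdjoint (hclosed : IsClosed (B : Set A))
    (hB : τ.BallComplete B) {a : A} (ha : IsSelfAdjoint a) :
    ∃ b ∈ B, ∀ c ∈ B, τ (star c * (a - b)) = 0 := by
  let K : Submodule ℂ τ.L2 := (B.toSubalgebra.toSubmodule.map τ.toL2).topologicalClosure
  have : CompleteSpace K := (Submodule.isClosed_topologicalClosure _).completeSpace_coe
  have mem_K {b : A} (hb : b ∈ B) : τ.toL2 b ∈ K :=
    Submodule.le_topologicalClosure _ (Submodule.mem_map_of_mem hb)
  obtain ⟨y, hy, hylim⟩ := mem_closure_iff_seq_limit.1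
    (Submodule.starProjection_apply_mem K (τ.toL2 a))
  choose b hbB hby using hy
  choose d hdB hd_norm hd_le using fun j =>
    τ.exists_mem_norm_le_twoNorm_sub_le hclosed (StarAlgHom.id ℂ A) ha (hbB j)
  have hdlim : Tendsto (fun j => τ.toL2 (d j)) atTop (𝓝 (K.starProjection (τ.toL2 a))) := by
    rw [tendsto_iff_norm_sub_tendsto_zero] at hylim ⊢
    refine squeeze_zero (fun _ => norm_nonneg _) (fun j => ?_) hylim
    rw [norm_sub_rev, norm_sub_rev (y j), ← hby]
    refine norm_starProjection_sub_le_of_norm_sub_le (mem_K (hdB j)) (mem_K (hbB j)) ?_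
    rw [← map_sub, ← map_sub, norm_toL2, norm_toL2]
    exact hd_le j
  obtain ⟨v, hvB, hv⟩ := hB d ‖a‖ hdB hd_norm hdlim.cauchySeq
  refine ⟨v, hvB, fun c hc => ?_⟩
  rw [← inner_toL2, map_sub, tendsto_nhds_unique hv hdlim]
  exact (Submodule.mem_orthogonal _ _).1 (Submodule.sub_starProjection_mem_orthogonal _) _
    (mem_K hc)

theorem exists_orthogonal (hclosed : IsClosed (B : Set A)) (hB : τ.BallComplete B) (a : A) :
    ∃ b ∈ B, ∀ c ∈ B, τ (star c * (a - b)) = 0 := by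
  obtain ⟨b, hb, hb'⟩ := exists_orthogonal_of_isSelfAdjoint hclosed hB (realPart a).2
  obtain ⟨c, hc, hc'⟩ := exists_orthogonal_of_isSelfAdjoint hclosed hB (imaginaryPart a).2
  refine ⟨b + Complex.I • c, B.add_mem hb (B.smul_mem hc _), fun d hd => ?_⟩
  have decomposition : a - (b + Complex.I • c) =
      ((realPart a : A) - b) + Complex.I • ((imaginaryPart a : A) - c) := by
    nth_rw 1 [← realPart_add_I_smul_imaginaryPart a]
    rw [smul_sub, add_sub_add_comm]
  rw [decomposition, mul_add, map_add, mul_smul_comm, map_smul, hb' d hd, hc' d hd, smul_zero,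
    add_zero]

end TracialState

/-! ### Extension of trace-preserving homomorphisms -/

namespace TracialState

theorem IsFaithful.exists_starAlgHom_of_graph {A U : Type*} [Ring A] [StarRing A] [Algebra ℂ A]
    [StarModule ℂ A] [Ring U] [StarRing U] [Algebra ℂ U] [StarModule ℂ U] {τ : TracialState A}
    {υ : TracialState U} (hυ : υ.IsFaithful) {Γ : StarSubalgebra ℂ (A × U)}
    (htr : ∀ p ∈ Γ, υ p.2 = τ p.1) (hsurj : ∀ a, ∃ u, (a, u) ∈ Γ) :
    ∃ ρ : A →⋆ₐ[ℂ] U, (∀ a, υ (ρ a) = τ a) ∧ ∀ p ∈ Γ, ρ p.1 = p.2 := by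
  let fst : Γ →⋆ₐ[ℂ] A := (StarAlgHom.fst ℂ A U).comp Γ.subtype
  have fst_injective : Function.Injective fst := (injective_iff_map_eq_zero fst).2 fun p hp => by
    have hp₁ : (p : A × U).1 = 0 := hp
    refine Subtype.ext (Prod.ext hp₁ (hυ _ ?_))
    have := htr _ (mul_mem (star_mem p.2) p.2)
    rwa [Prod.fst_mul, hp₁, mul_zero, map_zero] at this
  let e : Γ ≃⋆ₐ[ℂ] A := StarAlgEquiv.ofBijective fst
    ⟨fst_injective, fun a => (hsurj a).elim fun u hu => ⟨⟨(a, u), hu⟩, rfl⟩⟩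
  let ρ : A →⋆ₐ[ℂ] U :=
    ((StarAlgHom.snd ℂ A U).comp Γ.subtype).comp (e.symm : A →⋆ₐ[ℂ] Γ)
  have ρ_apply (p : Γ) : ρ (p : A × U).1 = (p : A × U).2 :=
    congrArg (fun q : Γ => (q : A × U).2) (e.symm_apply_apply p)
  refine ⟨ρ, fun a => ?_, fun p hp => ρ_apply ⟨p, hp⟩⟩
  obtain ⟨u, hu⟩ := hsurj a
  rw [ρ_apply ⟨(a, u), hu⟩, htr _ hu]

section Limits

variable {A : Type*} [CStarAlgebra A] (τ : TracialState A) {α : Type*} {l : Filter α} {g h : α → A}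
  {a b : A}

theorem tendsto_toL2_mul {C : ℝ} (hC : ∀ j, ‖g j‖ ≤ C)
    (hg : Tendsto (fun j => τ.toL2 (g j)) l (𝓝 (τ.toL2 a)))
    (hh : Tendsto (fun j => τ.toL2 (h j)) l (𝓝 (τ.toL2 b))) :
    Tendsto (fun j => τ.toL2 (g j * h j)) l (𝓝 (τ.toL2 (a * b))) := by
  rw [tendsto_toL2_iff] at hg hh ⊢
  have lim : Tendsto (fun j => C * τ.twoNorm (h j - b) + τ.twoNorm (g j - a) * ‖b‖) l (𝓝 0) := by
    simpa using (hh.const_mul C).add (hg.mul_const ‖b‖)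
  refine squeeze_zero (fun _ => τ.twoNorm_nonneg _) (fun j => ?_) lim
  calc τ.twoNorm (g j * h j - a * b) = τ.twoNorm (g j * (h j - b) + (g j - a) * b) := by
        rw [mul_sub, sub_mul, sub_add_sub_cancel]
    _ ≤ τ.twoNorm (g j * (h j - b)) + τ.twoNorm ((g j - a) * b) := τ.twoNorm_add_le _ _
    _ ≤ C * τ.twoNorm (h j - b) + τ.twoNorm (g j - a) * ‖b‖ := by
        refine add_le_add ((τ.twoNorm_mul_le _ _).trans ?_) (τ.twoNorm_mul_le' _ _)
        exact mul_le_mul_of_nonneg_right (hC j) (τ.twoNorm_nonneg _)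

theorem tendsto_toL2_star (hg : Tendsto (fun j => τ.toL2 (g j)) l (𝓝 (τ.toL2 a))) :
    Tendsto (fun j => τ.toL2 (star (g j))) l (𝓝 (τ.toL2 (star a))) := by
  rw [tendsto_toL2_iff] at hg ⊢
  simpa only [← star_sub, twoNorm_star] using hg

theorem tendsto_apply (hg : Tendsto (fun j => τ.toL2 (g j)) l (𝓝 (τ.toL2 a))) :
    Tendsto (fun j => τ (g j)) l (𝓝 (τ a)) := by
  simpa [inner_toL2] using tendsto_const_nhds.inner (𝕜 := ℂ) (x := τ.toL2 1) hg

end Limits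

variable {A N : Type*} [CStarAlgebra A] [CStarAlgebra N]

/-- The `*`-algebra of all pairs that are limits in `2`-norm, in both coordinates, of norm-bounded
sequences in `G`. -/
def boundedClosure (τ : TracialState A) (σ : TracialState N) (G : StarSubalgebra ℂ (A × N)) :
    StarSubalgebra ℂ (A × N) where
  carrier := {p | ∃ (g : ℕ → A × N) (C : ℝ), (∀ j, g j ∈ G) ∧ (∀ j, ‖g j‖ ≤ C) ∧
    Tendsto (fun j => τ.toL2 (g j).1) atTop (𝓝 (τ.toL2 p.1)) ∧
    Tendsto (fun j => σ.toL2 (g j).2) atTop (𝓝 (σ.toL2 p.2))}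
  algebraMap_mem' r := ⟨fun _ => algebraMap ℂ _ r, _, fun _ => algebraMap_mem G r, fun _ => le_rfl,
    tendsto_const_nhds, tendsto_const_nhds⟩
  add_mem' := by
    rintro p p' ⟨g, C, hG, hC, h₁, h₂⟩ ⟨g', C', hG', hC', h₁', h₂'⟩
    refine ⟨fun j => g j + g' j, C + C', fun j => add_mem (hG j) (hG' j),
      fun j => (norm_add_le _ _).trans (add_le_add (hC j) (hC' j)), ?_, ?_⟩
    · simpa only [Prod.fst_add, map_add] using h₁.add h₁'
    · simpa only [Prod.snd_add, map_add] using h₂.add h₂'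
  mul_mem' := by
    rintro p p' ⟨g, C, hG, hC, h₁, h₂⟩ ⟨g', C', hG', hC', h₁', h₂'⟩
    exact ⟨fun j => g j * g' j, C * C', fun j => mul_mem (hG j) (hG' j),
      fun j => (norm_mul_le _ _).trans
        (mul_le_mul (hC j) (hC' j) (norm_nonneg _) ((norm_nonneg _).trans (hC j))),
      τ.tendsto_toL2_mul (fun j => (norm_fst_le _).trans (hC j)) h₁ h₁',
      σ.tendsto_toL2_mul (fun j => (norm_snd_le _).trans (hC j)) h₂ h₂'⟩
  star_mem' := by
    rintro p ⟨g, C, hG, hC, h₁, h₂⟩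
    exact ⟨fun j => star (g j), C, fun j => star_mem (hG j), fun j => (norm_star _).le.trans (hC j),
      τ.tendsto_toL2_star h₁, σ.tendsto_toL2_star h₂⟩

variable {τ : TracialState A} {σ : TracialState N} {G : StarSubalgebra ℂ (A × N)}

theorem le_boundedClosure : G ≤ boundedClosure τ σ G := fun g hg =>
  ⟨fun _ => g, ‖g‖, fun _ => hg, fun _ => le_rfl, tendsto_const_nhds, tendsto_const_nhds⟩

theorem apply_snd_eq_of_mem_boundedClosure (htr : ∀ g ∈ G, σ g.2 = τ g.1) {p : A × N}
    (hp : p ∈ boundedClosure τ σ G) : σ p.2 = τ p.1 := by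
  obtain ⟨g, -, hG, -, h₁, h₂⟩ := hp
  refine tendsto_nhds_unique (σ.tendsto_apply h₂) ?_
  simpa only [htr _ (hG _)] using τ.tendsto_apply h₁

theorem exists_mem_boundedClosure_of_isSelfAdjoint (hσ : σ.BallComplete Set.univ)
    (hG : IsClosed (G : Set (A × N))) (htr : ∀ g ∈ G, σ g.2 = τ g.1)
    (hdense : ∀ a, ∀ ε > 0, ∃ g ∈ G, τ.twoNorm (a - g.1) < ε) {a : A} (ha : IsSelfAdjoint a) :
    ∃ u, (a, u) ∈ boundedClosure τ σ G := by
  choose g hg hga using fun j : ℕ => hdense a (1 / ((j : ℝ) + 1)) (by positivity)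
  choose k hkG hk_norm hk_le using fun j =>
    τ.exists_mem_norm_le_twoNorm_sub_le hG (StarAlgHom.fst ℂ A N) ha (hg j)
  have lim_fst : Tendsto (fun j => τ.toL2 (k j).1) atTop (𝓝 (τ.toL2 a)) := by
    rw [tendsto_toL2_iff]
    refine squeeze_zero (fun _ => τ.twoNorm_nonneg _) (fun j => ?_)
      tendsto_one_div_add_atTop_nhds_zero_nat
    rw [τ.twoNorm_sub_comm]
    exact (hk_le j).trans (hga j).le
  have isometry (i j : ℕ) :
      dist (σ.toL2 (k i).2) (σ.toL2 (k j).2) = dist (τ.toL2 (k i).1) (τ.toL2 (k j).1) := by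
    have := htr _ (mul_mem (star_mem (sub_mem (hkG i) (hkG j))) (sub_mem (hkG i) (hkG j)))
    rw [dist_eq_norm, dist_eq_norm, ← map_sub, ← map_sub, norm_toL2, norm_toL2]
    exact congrArg (fun z : ℂ => √z.re) this
  have cauchy_snd : CauchySeq (fun j => σ.toL2 (k j).2) := by
    simpa only [Metric.cauchySeq_iff, isometry] using lim_fst.cauchySeq
  obtain ⟨u, -, hu⟩ := hσ (fun j => (k j).2) ‖a‖ (fun _ => Set.mem_univ _)
    (fun j => (norm_snd_le (k j)).trans (hk_norm j)) cauchy_snd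
  exact ⟨u, k, ‖a‖, hkG, hk_norm, lim_fst, hu⟩

theorem exists_mem_boundedClosure (hσ : σ.BallComplete Set.univ) (hG : IsClosed (G : Set (A × N)))
    (htr : ∀ g ∈ G, σ g.2 = τ g.1) (hdense : ∀ a, ∀ ε > 0, ∃ g ∈ G, τ.twoNorm (a - g.1) < ε)
    (a : A) : ∃ u, (a, u) ∈ boundedClosure τ σ G := by
  obtain ⟨u, hu⟩ := exists_mem_boundedClosure_of_isSelfAdjoint hσ hG htr hdense (realPart a).2
  obtain ⟨v, hv⟩ := exists_mem_boundedClosure_of_isSelfAdjoint hσ hG htr hdense (imaginaryPart a).2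
  refine ⟨u + Complex.I • v, ?_⟩
  have := add_mem hu (StarSubalgebra.smul_mem _ hv Complex.I)
  rwa [Prod.smul_mk, Prod.mk_add_mk, realPart_add_I_smul_imaginaryPart] at this

/-- The homomorphism to be extended is given by its graph `G`. -/
theorem exists_starAlgHom_extending_graph (hσ : σ.BallComplete Set.univ)
    (hG : IsClosed (G : Set (A × N))) (htr : ∀ g ∈ G, σ g.2 = τ g.1)
    (hdense : ∀ a, ∀ ε > 0, ∃ g ∈ G, τ.twoNorm (a - g.1) < ε)
    {U : Type*} [Ring U] [StarRing U] [Algebra ℂ U] [StarModule ℂ U] {υ : TracialState U}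
    (hυ : υ.IsFaithful) (π : N →⋆ₐ[ℂ] U) (hπ : ∀ u, υ (π u) = σ u) :
    ∃ ρ : A →⋆ₐ[ℂ] U, (∀ a, υ (ρ a) = τ a) ∧ ∀ g ∈ G, ρ g.1 = π g.2 := by
  let Φ : A × N →⋆ₐ[ℂ] A × U :=
    (StarAlgHom.fst ℂ A N).prod (π.comp (StarAlgHom.snd ℂ A N))
  obtain ⟨ρ, hρ, hρΓ⟩ : ∃ ρ : A →⋆ₐ[ℂ] U,
      (∀ a, υ (ρ a) = τ a) ∧ ∀ p ∈ (boundedClosure τ σ G).map Φ, ρ p.1 = p.2 := by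
    refine hυ.exists_starAlgHom_of_graph ?_ fun a => ?_
    · rintro _ ⟨p, hp, rfl⟩
      exact (hπ _).trans (apply_snd_eq_of_mem_boundedClosure htr hp)
    · obtain ⟨u, hu⟩ := exists_mem_boundedClosure hσ hG htr hdense a
      exact ⟨π u, (a, u), hu, rfl⟩
  exact ⟨ρ, hρ, fun g hg => hρΓ (Φ g) ⟨g, le_boundedClosure hg, rfl⟩⟩

end TracialState

/-! ### Von Neumann algebras -/

theorem TracialState.tendsto_toL2_of_tendsto_apply_mul {A : Type*} [Ring A] [StarRing A]
    [Algebra ℂ A] [StarModule ℂ A] (τ : TracialState A) {α : Type*} [Preorder α] {u : α → A} {t : A}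
    {l : Filter α} [l.NeBot] (hl : l ≤ atTop) (hu : CauchySeq fun j => τ.toL2 (u j))
    (h : ∀ c, Tendsto (fun j => τ (c * u j)) l (𝓝 (τ (c * t)))) :
    Tendsto (fun j => τ.toL2 (u j)) atTop (𝓝 (τ.toL2 t)) := by
  obtain ⟨ξ, hξ⟩ := cauchySeq_tendsto_of_complete hu
  suffices ξ = τ.toL2 t from this ▸ hξ
  refine τ.denseRange_toL2.eq_of_inner_right ℂ fun c => ?_
  refine tendsto_nhds_unique (tendsto_const_nhds.inner (hξ.mono_left hl)) ?_
  simpa only [inner_toL2] using h (star c)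

theorem exists_norm_le_tendsto_of_ultrafilter {α E : Type*} [NormedAddCommGroup E] [ProperSpace E]
    (𝓤 : Ultrafilter α) {f : α → E} {C : ℝ} (hf : ∀ j, ‖f j‖ ≤ C) :
    ∃ z, ‖z‖ ≤ C ∧ Tendsto f 𝓤 (𝓝 z) := by
  have hle : (𝓤.map f : Filter E) ≤ 𝓟 (Metric.closedBall 0 C) :=
    tendsto_principal.2 (Eventually.of_forall fun j => mem_closedBall_zero_iff.2 (hf j))
  obtain ⟨z, hz, hz'⟩ := (isCompact_closedBall (0 : E) C).ultrafilter_le_nhds _ hle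
  exact ⟨z, mem_closedBall_zero_iff.1 hz, hz'⟩

section VonNeumann

variable {H : Type*} [NormedAddCommGroup H] [InnerProductSpace ℂ H] [CompleteSpace H]

theorem isClosed_vonNeumannAlgebra (M : VonNeumannAlgebra H) :
    IsClosed (M.toStarSubalgebra : Set (H →L[ℂ] H)) := by
  rw [VonNeumannAlgebra.coe_toStarSubalgebra, ← M.centralizer_centralizer]
  exact Set.isClosed_centralizer _

/-- A von Neumann algebra is a C*-algebra. -/
@[reducible]
def vonNeumannCStarAlgebra (M : VonNeumannAlgebra H) : CStarAlgebra M.toStarSubalgebra :=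
  StarSubalgebra.cstarAlgebra _ (h_closed := isClosed_vonNeumannAlgebra M)

attribute [local instance] vonNeumannCStarAlgebra

theorem exists_weak_limit {α : Type*} (𝓤 : Ultrafilter α) {u : α → H →L[ℂ] H} {C : ℝ}
    (hu : ∀ j, ‖u j‖ ≤ C) :
    ∃ T : H →L[ℂ] H, ∀ v w, Tendsto (fun j => inner ℂ v (u j w)) 𝓤 (𝓝 (inner ℂ v (T w))) := by
  have bound (v w : H) (j : α) : ‖inner ℂ (u j v) w‖ ≤ C * ‖v‖ * ‖w‖ :=
    (norm_inner_le_norm _ _).trans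
      (mul_le_mul_of_nonneg_right ((u j).le_of_opNorm_le (hu j) v) (norm_nonneg w))
  choose f hf_norm hf using fun v w => exists_norm_le_tendsto_of_ultrafilter 𝓤 (bound v w)
  let B : H →ₗ⋆[ℂ] H →ₗ[ℂ] ℂ := LinearMap.mk₂'ₛₗ (starRingEnd ℂ) (RingHom.id ℂ) f
    (fun v v' w => tendsto_nhds_unique (hf _ w)
      (by simpa only [map_add, inner_add_left] using (hf v w).add (hf v' w)))
    (fun c v w => tendsto_nhds_unique (hf _ w)
      (by simpa only [map_smul, inner_smul_left, smul_eq_mul, RingHom.id_apply] using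
        (hf v w).const_mul (starRingEnd ℂ c)))
    (fun v w w' => tendsto_nhds_unique (hf v _)
      (by simpa only [inner_add_right] using (hf v w).add (hf v w')))
    (fun c v w => tendsto_nhds_unique (hf v _)
      (by simpa only [inner_smul_right, smul_eq_mul, RingHom.id_apply] using
        (hf v w).const_mul c))
  refine ⟨InnerProductSpace.continuousLinearMapOfBilin (B.mkContinuous₂ C hf_norm), fun v w => ?_⟩
  rw [← inner_conj_symm, InnerProductSpace.continuousLinearMapOfBilin_apply]
  exact ((Complex.continuous_conj.tendsto _).comp (hf w v)).congr fun j => inner_conj_symm _ _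

theorem mem_centralizer_of_weak_limit {α : Type*} {l : Filter α} [l.NeBot] {u : α → H →L[ℂ] H}
    {T : H →L[ℂ] H} {S : Set (H →L[ℂ] H)} (hu : ∀ j, u j ∈ S.centralizer)
    (hT : ∀ v w, Tendsto (fun j => inner ℂ v (u j w)) l (𝓝 (inner ℂ v (T w)))) :
    T ∈ S.centralizer := by
  intro y hy
  ext w
  refine ext_inner_left ℂ fun v => tendsto_nhds_unique ?_ (hT v (y w))
  have lim := hT (ContinuousLinearMap.adjoint y v) w
  simp only [ContinuousLinearMap.adjoint_inner_left] at lim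
  exact lim.congr fun j => congrArg (inner ℂ v) (DFunLike.congr_fun (hu j y hy) w)

variable {M : VonNeumannAlgebra H} {τ : TracialState M.toStarSubalgebra}

theorem IsNormalState.tendsto_apply (hτ : IsNormalState M τ) {α : Type*} {l : Filter α}
    {u : α → M.toStarSubalgebra} {t : M.toStarSubalgebra} {C : ℝ} (hC : ∀ j, ‖u j‖ ≤ C)
    (hu : ∀ v w, Tendsto (fun j => inner ℂ v ((u j : H →L[ℂ] H) w)) l
      (𝓝 (inner ℂ v ((t : H →L[ℂ] H) w)))) :
    Tendsto (fun j => τ (u j)) l (𝓝 (τ t)) := by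
  obtain ⟨ξ, η, hξ, hη, hsum⟩ := hτ
  simp_rw [← (hsum _).tsum_eq]
  refine tendsto_tsum_of_dominated_convergence ((hξ.add hη).mul_left C) (fun i => hu _ _)
    (Eventually.of_forall fun j i => ?_)
  have amgm : ‖ξ i‖ * ‖η i‖ ≤ ‖ξ i‖ ^ 2 + ‖η i‖ ^ 2 := by
    nlinarith [sq_nonneg (‖ξ i‖ - ‖η i‖), sq_nonneg ‖ξ i‖, sq_nonneg ‖η i‖]
  calc ‖inner ℂ (ξ i) ((u j : H →L[ℂ] H) (η i))‖
      ≤ ‖ξ i‖ * (C * ‖η i‖) := (norm_inner_le_norm _ _).trans (mul_le_mul_of_nonneg_left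
        ((u j : H →L[ℂ] H).le_of_opNorm_le (hC j) _) (norm_nonneg _))
    _ = C * (‖ξ i‖ * ‖η i‖) := by ring
    _ ≤ C * (‖ξ i‖ ^ 2 + ‖η i‖ ^ 2) :=
        mul_le_mul_of_nonneg_left amgm ((norm_nonneg _).trans (hC j))

theorem IsNormalState.ballComplete (hτ : IsNormalState M τ) {P : VonNeumannAlgebra H}
    (hPM : P ≤ M) : τ.BallComplete {a | (a : H →L[ℂ] H) ∈ P} := by
  intro u C huP huC hcauchy
  obtain ⟨T, hT⟩ := exists_weak_limit (hyperfilter ℕ) (u := fun j => (u j : H →L[ℂ] H)) huC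
  have hTP : T ∈ P := by
    have huP' (j : ℕ) : (u j : H →L[ℂ] H) ∈ (P : Set (H →L[ℂ] H)).centralizer.centralizer :=
      P.centralizer_centralizer.symm ▸ huP j
    rw [← SetLike.mem_coe, ← P.centralizer_centralizer]
    exact mem_centralizer_of_weak_limit huP' hT
  refine ⟨⟨T, hPM hTP⟩, hTP,
    τ.tendsto_toL2_of_tendsto_apply_mul Nat.hyperfilter_le_atTop hcauchy fun c => ?_⟩
  refine hτ.tendsto_apply (C := ‖c‖ * C) (fun j => (norm_mul_le _ _).trans
    (mul_le_mul_of_nonneg_left (huC j) (norm_nonneg c))) fun v w => ?_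
  have lim := hT (ContinuousLinearMap.adjoint (c : H →L[ℂ] H) v) w
  simp only [ContinuousLinearMap.adjoint_inner_left] at lim
  exact lim

theorem vnInclusion_injective {P : VonNeumannAlgebra H} (hPM : P ≤ M) :
    Function.Injective (vnInclusion hPM) :=
  fun _ _ h => Subtype.ext (congrArg (Subtype.val : M.toStarSubalgebra → H →L[ℂ] H) h)

theorem existsUnique_condExp_vnInclusion (hfaithful : τ.IsFaithful) (hnormal : IsNormalState M τ)
    {P : VonNeumannAlgebra H} (hPM : P ≤ M) :
    ∃! E : M.toStarSubalgebra →ₗ[ℂ] P.toStarSubalgebra,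
      IsTracialCondExp τ (vnInclusion hPM) E := by
  have isClosed_comap : IsClosed (P.toStarSubalgebra.comap M.toStarSubalgebra.subtype :
      Set M.toStarSubalgebra) := (isClosed_vonNeumannAlgebra P).preimage continuous_subtype_val
  obtain ⟨E, hE⟩ := IsTracialCondExp.exists_of_orthogonal hfaithful (vnInclusion_injective hPM)
    fun a => by
      obtain ⟨b, hb, h_orth⟩ :=
        TracialState.exists_orthogonal isClosed_comap (hnormal.ballComplete hPM) a
      exact ⟨⟨b, hb⟩, fun c => h_orth _ c.2⟩
  exact ⟨E, hE, fun E' hE' =>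
    IsTracialCondExp.unique hfaithful (vnInclusion_injective hPM) hE' hE⟩

end VonNeumann

/-! ### The double commutant theorem -/

section DoubleCommutant

attribute [local instance] vonNeumannCStarAlgebra

variable {H : Type*} [NormedAddCommGroup H] [InnerProductSpace ℂ H] [CompleteSpace H]

theorem commute_starProjection {K : Submodule ℂ H} [K.HasOrthogonalProjection] {T : H →L[ℂ] H}
    (hT : ∀ v ∈ K, T v ∈ K) (hT' : ∀ v ∈ K, star T v ∈ K) : Commute K.starProjection T := by
  rw [ContinuousLinearMap.IsIdempotentElem.commute_iff K.isIdempotentElem_starProjection,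
    K.range_starProjection, K.ker_starProjection]
  exact ⟨hT, ContinuousLinearMap.orthogonal_mem_invtSubmodule hT'⟩

/-- The representation of `B(H)` on `ℓ²(ι, H)` that acts by the same operator on every
coordinate. -/
def diagonalRep (ι H : Type*) [NormedAddCommGroup H] [InnerProductSpace ℂ H] [CompleteSpace H] :
    (H →L[ℂ] H) →⋆ₐ[ℂ] (lp (fun _ : ι => H) 2 →L[ℂ] lp (fun _ : ι => H) 2) where
  toFun a := lp.mapCLM 2 (fun _ => a) (norm_nonneg a) fun _ => le_rfl
  map_one' := rfl
  map_mul' _ _ := rfl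
  map_zero' := rfl
  map_add' _ _ := rfl
  commutes' _ := rfl
  map_star' a := (ContinuousLinearMap.eq_adjoint_iff _ _).2 fun f g => by
    rw [lp.inner_eq_tsum, lp.inner_eq_tsum]
    exact tsum_congr fun i => a.adjoint_inner_left _ _

variable {ι : Type*}

theorem diagonalRep_apply (a : H →L[ℂ] H) (f : lp (fun _ : ι => H) 2) (i : ι) :
    diagonalRep ι H a f i = a (f i) := rfl

theorem diagonalRep_single [DecidableEq ι] (a : H →L[ℂ] H) (i : ι) (v : H) :
    diagonalRep ι H a (lp.single 2 i v) = lp.single 2 i (a v) :=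
  lp.ext (funext fun j => by
    rw [diagonalRep_apply, lp.single_apply, lp.single_apply,
      Pi.apply_single (fun _ => a) fun _ => map_zero a])

theorem commute_diagonalRep_of_mem_centralizer_centralizer {S : Set (H →L[ℂ] H)}
    {Q : lp (fun _ : ι => H) 2 →L[ℂ] lp (fun _ : ι => H) 2}
    (hQ : ∀ b ∈ S, Commute Q (diagonalRep ι H b)) {a : H →L[ℂ] H}
    (ha : a ∈ S.centralizer.centralizer) : Commute Q (diagonalRep ι H a) := by
  classical
  let entry (i j : ι) : H →L[ℂ] H :=
    lp.evalCLM ℂ (fun _ => H) 2 i ∘L Q ∘L lp.singleContinuousLinearMap ℂ (fun _ => H) 2 j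
  have entry_mem (i j : ι) : entry i j ∈ S.centralizer := by
    intro b hb
    ext v
    change diagonalRep ι H b (Q (lp.single 2 j v)) i = Q (lp.single 2 j (b v)) i
    rw [← diagonalRep_single]
    exact congrArg (· i) (DFunLike.congr_fun (hQ b hb) (lp.single 2 j v)).symm
  refine lp.ext_continuousLinearMap ENNReal.ofNat_ne_top fun j => ?_
  ext v : 1
  refine lp.ext (funext fun i => ?_)
  change Q (diagonalRep ι H a (lp.single 2 j v)) i = a (entry i j v)
  rw [diagonalRep_single]
  exact DFunLike.congr_fun (ha _ (entry_mem i j)) v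

theorem exists_norm_diagonalRep_sub_lt (S : StarSubalgebra ℂ (H →L[ℂ] H)) {a : H →L[ℂ] H}
    (ha : a ∈ (S : Set (H →L[ℂ] H)).centralizer.centralizer) (ζ : lp (fun _ : ι => H) 2)
    {ε : ℝ} (hε : 0 < ε) : ∃ b ∈ S, ‖diagonalRep ι H (a - b) ζ‖ < ε := by
  let orbit : Submodule ℂ (lp (fun _ : ι => H) 2) :=
    (S.toSubalgebra.toSubmodule.map (diagonalRep ι H).toAlgHom.toLinearMap).map
      (ContinuousLinearMap.apply ℂ _ ζ).toLinearMap
  let K := orbit.topologicalClosure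
  have : CompleteSpace K := orbit.isClosed_topologicalClosure.completeSpace_coe
  have orbit_subset (b : H →L[ℂ] H) (hb : b ∈ S) : diagonalRep ι H b ζ ∈ K :=
    subset_closure ⟨_, ⟨b, hb, rfl⟩, rfl⟩
  have invariant (b : H →L[ℂ] H) (hb : b ∈ S) (f) (hf : f ∈ K) : diagonalRep ι H b f ∈ K := by
    refine map_mem_closure (diagonalRep ι H b).continuous hf ?_
    rintro _ ⟨_, ⟨c, hc, rfl⟩, rfl⟩
    exact ⟨_, ⟨b * c, S.mul_mem hb hc, rfl⟩, rfl⟩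
  have commute : Commute K.starProjection (diagonalRep ι H a) :=
    commute_diagonalRep_of_mem_centralizer_centralizer (fun b hb => commute_starProjection
      (invariant b hb) (map_star (diagonalRep ι H) b ▸ invariant _ (star_mem hb))) ha
  have hζ : K.starProjection ζ = ζ := Submodule.starProjection_eq_self_iff.2 <| by
    simpa only [map_one, one_apply_eq_self] using orbit_subset 1 S.one_mem
  have haζ : diagonalRep ι H a ζ ∈ K := by
    have key := DFunLike.congr_fun commute.eq ζ
    simp only [mul_apply_eq_comp, hζ] at key
    exact key ▸ K.starProjection_apply_mem _
  obtain ⟨_, ⟨_, ⟨b, hb, rfl⟩, rfl⟩, hlt⟩ := Metric.mem_closure_iff.1 haζ ε hε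
  exact ⟨b, hb, by rwa [map_sub, sub_apply, ← dist_eq_norm]⟩

/-- The von Neumann algebra `(S ∪ S*)''` generated by a set `S` of operators. -/
def bicommutant (S : Set (H →L[ℂ] H)) : VonNeumannAlgebra H where
  __ := StarSubalgebra.centralizer ℂ (StarSubalgebra.centralizer ℂ S : Set (H →L[ℂ] H))
  centralizer_centralizer' := by
    change Set.centralizer (Set.centralizer (StarSubalgebra.centralizer ℂ
      (StarSubalgebra.centralizer ℂ S : Set (H →L[ℂ] H)) : Set (H →L[ℂ] H))) = _
    rw [StarSubalgebra.coe_centralizer_centralizer, Set.centralizer_centralizer_centralizer]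
    exact (StarSubalgebra.coe_centralizer_centralizer ℂ S).symm

theorem mem_bicommutant_iff {S : StarSubalgebra ℂ (H →L[ℂ] H)} {a : H →L[ℂ] H} :
    a ∈ bicommutant (S : Set (H →L[ℂ] H)) ↔
      a ∈ (S : Set (H →L[ℂ] H)).centralizer.centralizer := by
  change a ∈ (StarSubalgebra.centralizer ℂ
    (StarSubalgebra.centralizer ℂ (S : Set (H →L[ℂ] H)) : Set (H →L[ℂ] H)) : Set (H →L[ℂ] H)) ↔ _
  rw [StarSubalgebra.coe_centralizer_centralizer, StarMemClass.star_coe_eq, Set.union_self]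

variable {M : VonNeumannAlgebra H} {τ : TracialState M.toStarSubalgebra}

theorem IsNormalState.exists_twoNorm_le (hτ : IsNormalState M τ) :
    ∃ ζ : lp (fun _ : ℕ => H) 2, ∀ a : M.toStarSubalgebra,
      τ.twoNorm a ≤ ‖diagonalRep ℕ H (a : H →L[ℂ] H) ζ‖ := by
  obtain ⟨ξ, η, hξ, hη, hsum⟩ := hτ
  let ξ' : lp (fun _ : ℕ => H) 2 := ⟨ξ, memℓp_gen (by simpa using hξ)⟩
  let η' : lp (fun _ : ℕ => H) 2 := ⟨η, memℓp_gen (by simpa using hη)⟩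
  refine ⟨ξ' + η', fun a => le_of_sq_le_sq ?_ (norm_nonneg _)⟩
  set T := diagonalRep ℕ H (a : H →L[ℂ] H)
  have apply_eq : τ (star a * a) = inner ℂ (T ξ') (T η') := by
    rw [lp.inner_eq_tsum, ← (hsum (star a * a)).tsum_eq]
    exact tsum_congr fun i => ContinuousLinearMap.adjoint_inner_right (a : H →L[ℂ] H) _ _
  calc τ.twoNorm a ^ 2
      = (‖T ξ' + T η'‖ * ‖T ξ' + T η'‖ - ‖T ξ' - T η'‖ * ‖T ξ' - T η'‖) / 4 := by
        rw [← re_inner_eq_norm_add_mul_self_sub_norm_sub_mul_self_div_four (𝕜 := ℂ), ← apply_eq,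
          ← τ.ofReal_twoNorm_sq]
        exact (Complex.ofReal_re _).symm
    _ ≤ ‖T (ξ' + η')‖ ^ 2 := by
        rw [map_add]
        nlinarith [sq_nonneg ‖T ξ' + T η'‖, mul_self_nonneg ‖T ξ' - T η'‖]

theorem GeneratedBy.exists_twoNorm_sub_lt {I : Type*} {x : I → M.toStarSubalgebra}
    (hx : GeneratedBy M x) (hτ : IsNormalState M τ) (a : M.toStarSubalgebra) {ε : ℝ}
    (hε : 0 < ε) : ∃ b ∈ StarAlgebra.adjoin ℂ (Set.range x), τ.twoNorm (a - b) < ε := by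
  obtain ⟨ζ, hζ⟩ := hτ.exists_twoNorm_le
  let S := (StarAlgebra.adjoin ℂ (Set.range x)).map M.toStarSubalgebra.subtype
  have le_bicommutant : M ≤ bicommutant (S : Set (H →L[ℂ] H)) :=
    hx _ fun i => mem_bicommutant_iff.2 <| Set.subset_centralizer_centralizer
      ⟨x i, StarAlgebra.subset_adjoin ℂ _ ⟨i, rfl⟩, rfl⟩
  obtain ⟨_, ⟨b, hb, rfl⟩, hlt⟩ :=
    exists_norm_diagonalRep_sub_lt S (mem_bicommutant_iff.1 (le_bicommutant a.2)) ζ hε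
  exact ⟨b, hb, (hζ (a - b)).trans_lt hlt⟩

end DoubleCommutant

/-! ### Tracial ultraproducts -/

namespace TracialState

variable {A B : Type*} [Ring A] [StarRing A] [Algebra ℂ A] [Ring B] [StarRing B] [Algebra ℂ B]

theorem nontrivial (τ : TracialState A) : Nontrivial A :=
  ⟨1, 0, fun h => one_ne_zero (α := ℂ) (by rw [← τ.map_one, h, map_zero])⟩

/-- The pullback of a tracial state along a unital `*`-homomorphism. -/
def comap (τ : TracialState B) (φ : A →⋆ₐ[ℂ] B) : TracialState A where
  toLinearMap := τ.toLinearMap ∘ₗ φ.toAlgHom.toLinearMap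
  map_one' := (congrArg τ.toLinearMap (_root_.map_one φ)).trans τ.map_one
  nonneg' a := by
    change 0 ≤ τ (φ (star a * a))
    rw [map_mul φ, map_star φ]
    exact τ.nonneg (φ a)
  tracial' a b := by
    change τ (φ (a * b)) = τ (φ (b * a))
    rw [map_mul φ, map_mul φ, τ.tracial]

theorem twoNorm_comap (τ : TracialState B) (φ : A →⋆ₐ[ℂ] B) (a : A) :
    (τ.comap φ).twoNorm a = τ.twoNorm (φ a) :=
  (twoNorm_map (fun _ => rfl) a).symm

end TracialState

namespace TracialUltraproduct

section CondExp

variable {A : ℕ → Type*} [∀ k, CStarAlgebra (A k)] (τ : ∀ k, TracialState (A k)) (ω : Ultrafilter ℕ)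

theorem tendsto_twoNorm (a : boundedSeq A) :
    Tendsto (fun k => (τ k).twoNorm (a.1 k)) ω (𝓝 ((trace τ ω).twoNorm (mk τ ω a))) := by
  rw [TracialState.twoNorm, ← map_star (mk τ ω), ← map_mul (mk τ ω)]
  exact ((Complex.continuous_re.tendsto _).comp (tendsto_limTrace τ ω (star a * a))).sqrt

theorem isFaithful_trace : (trace τ ω).IsFaithful := by
  intro u hu
  obtain ⟨a, rfl⟩ := mk_surjective τ ω u
  have lim := tendsto_twoNorm τ ω a
  rw [TracialState.twoNorm, hu, Complex.zero_re, Real.sqrt_zero] at lim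
  rw [← _root_.map_zero (mk τ ω), mk_eq_iff]
  exact lim.congr fun k => congrArg _ (sub_zero (a.1 k)).symm

variable {B : ℕ → Type*} [∀ k, CStarAlgebra (B k)] (σ : ∀ k, TracialState (B k))
  (φ : ∀ k, A k →⋆ₐ[ℂ] B k) (hφ : ∀ k a, σ k (φ k a) = τ k a)

theorem trace_map (u : TracialUltraproduct τ ω) :
    trace σ ω (map τ ω σ φ hφ u) = trace τ ω u := by
  obtain ⟨a, rfl⟩ := mk_surjective τ ω u
  exact limTrace_eq σ ω ((tendsto_limTrace τ ω a).congr fun k => (hφ k _).symm)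

theorem map_injective : Function.Injective (map τ ω σ φ hφ) :=
  (isFaithful_trace τ ω).injective (trace_map τ ω σ φ hφ)

variable {e : ∀ k, B k →ₗ[ℂ] A k}

theorem apply_mem_boundedSeq (hle : ∀ k b, ‖e k b‖ ≤ ‖b‖) (b : boundedSeq B) :
    (fun k => e k (b.1 k)) ∈ boundedSeq A :=
  b.2.imp fun _ hC k => (hle k _).trans (hC k)

theorem trace_star_map_mul_sub (he : ∀ k, IsTracialCondExp (σ k) (φ k) (e k))
    (b : boundedSeq B) (heb : (fun k => e k (b.1 k)) ∈ boundedSeq A) (c : TracialUltraproduct τ ω) :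
    trace σ ω (star (map τ ω σ φ hφ c) * (mk σ ω b - map τ ω σ φ hφ (mk τ ω ⟨_, heb⟩))) = 0 := by
  obtain ⟨c, rfl⟩ := mk_surjective τ ω c
  exact limTrace_eq σ ω (tendsto_const_nhds.congr fun k =>
    ((he k).apply_incl_star_mul_sub (c.1 k) (b.1 k)).symm)

theorem exists_isTracialCondExp_map (he : ∀ k, IsTracialCondExp (σ k) (φ k) (e k))
    (hle : ∀ k b, ‖e k b‖ ≤ ‖b‖) :
    ∃ E, IsTracialCondExp (trace σ ω) (map τ ω σ φ hφ) E := by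
  refine IsTracialCondExp.exists_of_orthogonal (isFaithful_trace σ ω)
    (map_injective τ ω σ φ hφ) fun u => ?_
  obtain ⟨b, rfl⟩ := mk_surjective σ ω u
  exact ⟨_, trace_star_map_mul_sub τ ω σ φ hφ he b (apply_mem_boundedSeq hle b)⟩

theorem condExp_mk (he : ∀ k, IsTracialCondExp (σ k) (φ k) (e k))
    {E : TracialUltraproduct σ ω →ₗ[ℂ] TracialUltraproduct τ ω}
    (hE : IsTracialCondExp (trace σ ω) (map τ ω σ φ hφ) E) (b : boundedSeq B)
    (heb : (fun k => e k (b.1 k)) ∈ boundedSeq A) : E (mk σ ω b) = mk τ ω ⟨_, heb⟩ :=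
  (isFaithful_trace σ ω).eq_of_orthogonal (map_injective τ ω σ φ hφ)
    (fun c => hE.apply_incl_star_mul_sub c _) (trace_star_map_mul_sub τ ω σ φ hφ he b heb)

theorem tendsto_twoNorm_condExp (he : ∀ k, IsTracialCondExp (σ k) (φ k) (e k))
    (hle : ∀ k b, ‖e k b‖ ≤ ‖b‖) {E : TracialUltraproduct σ ω →ₗ[ℂ] TracialUltraproduct τ ω}
    (hE : IsTracialCondExp (trace σ ω) (map τ ω σ φ hφ) E) (b : boundedSeq B) :
    Tendsto (fun k => (τ k).twoNorm (e k (b.1 k))) ω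
      (𝓝 ((trace σ ω).twoNorm (map τ ω σ φ hφ (E (mk σ ω b))))) := by
  rw [TracialState.twoNorm_map (trace_map τ ω σ φ hφ),
    condExp_mk τ ω σ φ hφ he hE b (apply_mem_boundedSeq hle b)]
  exact tendsto_twoNorm τ ω _

end CondExp

section BallComplete

theorem exists_diagonal {l : Filter ℕ} (hl : l ≤ atTop) {Q : ℕ → ℕ → Prop}
    (hQ : ∀ m, ∀ᶠ k in l, Q m k) : ∃ m : ℕ → ℕ, ∀ n, ∀ᶠ k in l, n ≤ m k ∧ Q (m k) k := by
  classical
  refine ⟨fun k => Nat.findGreatest (Q · k) k, fun n => ?_⟩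
  filter_upwards [hl (eventually_ge_atTop n), hQ n] with k hnk hk
  exact ⟨Nat.le_findGreatest hnk hk, Nat.findGreatest_spec (P := (Q · k)) hnk hk⟩

instance instCStarAlgebraLpInfty {ι : Type*} {A : ι → Type*} [∀ i, Nontrivial (A i)]
    [∀ i, CStarAlgebra (A i)] : CStarAlgebra (lp A ∞) where

variable {A : ℕ → Type*} [∀ k, Nontrivial (A k)] [∀ k, CStarAlgebra (A k)]

/-- The `ℓ^∞`-product as the algebra of bounded sequences. -/
def lpEquivBoundedSeq (A : ℕ → Type*) [∀ k, Nontrivial (A k)] [∀ k, CStarAlgebra (A k)] :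
    lp A ∞ ≃⋆ₐ[ℂ] boundedSeq A where
  toFun f := ⟨f, ‖f‖, lp.norm_apply_le_norm ENNReal.top_ne_zero f⟩
  invFun a := ⟨a.1, memℓp_infty (a.2.imp fun _ hC => Set.forall_mem_range.2 hC)⟩
  left_inv _ := rfl
  right_inv _ := rfl
  map_mul' _ _ := rfl
  map_add' _ _ := rfl
  map_smul' _ _ := rfl
  map_star' _ := rfl

variable (τ : ∀ k, TracialState (A k)) (ω : Ultrafilter ℕ)

/-- The quotient map from the `ℓ^∞`-product onto the tracial ultraproduct. -/
def ofLp : lp A ∞ →⋆ₐ[ℂ] TracialUltraproduct τ ω :=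
  (mk τ ω).comp (lpEquivBoundedSeq A : lp A ∞ →⋆ₐ[ℂ] boundedSeq A)

/-- The limit along `ω` of the traces on the `ℓ^∞`-product. -/
def lpTrace : TracialState (lp A ∞) := (trace τ ω).comap (ofLp τ ω)

theorem tendsto_twoNorm_lp (f : lp A ∞) :
    Tendsto (fun k => (τ k).twoNorm (f k)) ω (𝓝 ((lpTrace τ ω).twoNorm f)) := by
  rw [lpTrace, TracialState.twoNorm_comap]
  exact tendsto_twoNorm τ ω (lpEquivBoundedSeq A f)

theorem ballComplete_lpTrace (hω : (ω : Filter ℕ) ≤ atTop) :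
    (lpTrace τ ω).BallComplete Set.univ := by
  intro u C _ hC hcauchy
  obtain ⟨b, -, hub, hb⟩ := cauchySeq_iff_le_tendsto_0.1 hcauchy
  have eventually_le (m : ℕ) : ∀ᶠ k in (ω : Filter ℕ),
      ∀ i ≤ m, (τ k).twoNorm (u i k - u m k) ≤ b i + 1 / ((i : ℝ) + 1) := by
    refine (eventually_all_finite (Set.finite_le_nat m)).2 fun i hi => ?_
    refine ((tendsto_twoNorm_lp τ ω (u i - u m)).eventually_le_const ?_)
    rw [← TracialState.norm_toL2, map_sub, ← dist_eq_norm]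
    exact (hub i m i le_rfl hi).trans_lt (lt_add_of_pos_right _ Nat.one_div_pos_of_nat)
  obtain ⟨m, hm⟩ := exists_diagonal hω eventually_le
  let v : lp A ∞ := ⟨fun k => u (m k) k, memℓp_infty ⟨C, by
    rintro _ ⟨k, rfl⟩
    exact (lp.norm_apply_le_norm ENNReal.top_ne_zero (u (m k)) k).trans (hC _)⟩⟩
  refine ⟨v, Set.mem_univ v, (lpTrace τ ω).tendsto_toL2_iff.2 ?_⟩
  refine squeeze_zero (fun i => TracialState.twoNorm_nonneg _ _) (fun i => ?_)
    (by simpa only [add_zero] using hb.add tendsto_one_div_add_atTop_nhds_zero_nat)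
  exact le_of_tendsto (tendsto_twoNorm_lp τ ω (u i - v))
    ((hm i).mono fun k hk => hk.2 i hk.1)

end BallComplete

end TracialUltraproduct

/-! ### Expectations of bounded random variables -/

theorem map_freeAlgebraLift {R A B I F : Type*} [CommSemiring R] [Semiring A] [Algebra R A]
    [Semiring B] [Algebra R B] [FunLike F A B] [AlgHomClass F R A B] (f : F) (x : I → A)
    (p : FreeAlgebra R I) :
    f (FreeAlgebra.lift R x p) = FreeAlgebra.lift R (fun i => f (x i)) p := by
  suffices h : (AlgHomClass.toAlgHom f).comp (FreeAlgebra.lift R x) =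
      FreeAlgebra.lift R fun i => f (x i) from DFunLike.congr_fun h p
  ext i
  simp

namespace TracialState

theorem continuous {A : Type*} [CStarAlgebra A] (τ : TracialState A) : Continuous τ :=
  AddMonoidHomClass.continuous_of_bound τ.toLinearMap 1 fun a =>
    (τ.norm_apply_le a).trans_eq (one_mul _).symm

end TracialState

namespace Linfty

variable {Ω : Type*} [MeasurableSpace Ω] {μ : Measure Ω} {A : Type*} [CStarAlgebra A]

theorem coeFn_lift {I : Type*} {X : I → Ω → A} {Y : I → Linfty μ A} (h : ∀ i, Y i =ᵐ[μ] X i)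
    (p : FreeAlgebra ℂ I) : (FreeAlgebra.lift ℂ Y p : Linfty μ A) =ᵐ[μ]
      fun w => FreeAlgebra.lift ℂ (fun i => X i w) p := by
  induction p using FreeAlgebra.induction with
  | grade0 r =>
    rw [AlgHom.commutes, Algebra.algebraMap_eq_smul_one]
    filter_upwards [coeFn_smul r (1 : Linfty μ A), coeFn_one (μ := μ) (A := A)] with w h_smul h_one
    rw [h_smul, h_one, AlgHom.commutes, Algebra.algebraMap_eq_smul_one]
  | grade1 i =>
    rw [FreeAlgebra.lift_ι_apply]
    filter_upwards [h i] with w hw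
    rw [hw, FreeAlgebra.lift_ι_apply]
  | mul p q hp hq =>
    rw [map_mul]
    filter_upwards [coeFn_mul (FreeAlgebra.lift ℂ Y p) (FreeAlgebra.lift ℂ Y q), hp, hq]
      with w h_mul hpw hqw
    rw [h_mul, hpw, hqw, map_mul]
  | add p q hp hq =>
    rw [map_add]
    filter_upwards [coeFn_add (FreeAlgebra.lift ℂ Y p) (FreeAlgebra.lift ℂ Y q), hp, hq]
      with w h_add hpw hqw
    rw [h_add, hpw, hqw, map_add]

section Expectation

variable [IsProbabilityMeasure μ]

/-- The expectation `𝔼 : L^∞(Ω, A) → A`. -/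
def expectation (μ : Measure Ω) (A : Type*) [CStarAlgebra A] [IsProbabilityMeasure μ] :
    Linfty μ A →ₗ[ℂ] A where
  toFun f := ∫ w, f w ∂μ
  map_add' f g := by
    rw [← integral_add f.integrable g.integrable]
    exact integral_congr_ae (coeFn_add f g)
  map_smul' c f := by
    rw [RingHom.id_apply, ← integral_smul]
    exact integral_congr_ae (coeFn_smul c f)

theorem expectation_apply (f : Linfty μ A) : expectation μ A f = ∫ w, f w ∂μ := rfl

theorem norm_expectation_le (f : Linfty μ A) : ‖expectation μ A f‖ ≤ ‖f‖ := by
  simpa only [expectation_apply, probReal_univ, mul_one] using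
    norm_integral_le_of_norm_le_const f.ae_norm_le

theorem isTracialCondExp_expectation (τ : TracialState A) :
    IsTracialCondExp (tracialState μ τ) (const μ A) (expectation μ A) where
  map_incl a := by
    rw [expectation_apply, integral_congr_ae (coeFn_const a), integral_const, probReal_univ,
      one_smul]
  map_bimodule a f b := by
    have h : (const μ A a * f * const μ A b : Linfty μ A) =ᵐ[μ] fun w => a * f w * b := by
      filter_upwards [coeFn_mul (const μ A a * f) (const μ A b), coeFn_mul (const μ A a) f,
        coeFn_const (μ := μ) a, coeFn_const (μ := μ) b] with w h_mul_b h_mul_a ha hb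
      rw [h_mul_b, h_mul_a, ha, hb]
    rw [expectation_apply, integral_congr_ae h]
    exact (((ContinuousLinearMap.mul ℂ A).flip b).comp
      (ContinuousLinearMap.mul ℂ A a)).integral_comp_comm f.integrable
  trace_preserving f := by
    rw [tracialState_const]
    exact (ContinuousLinearMap.integral_comp_comm ⟨τ.toLinearMap, τ.continuous⟩ f.integrable).symm

end Expectation

end Linfty

/-! ### Homomorphisms determined by generators -/

theorem exists_lift_eq_of_mem_adjoin {A : Type*} [Ring A] [StarRing A] [Algebra ℂ A]
    [StarModule ℂ A] {I : Type*} {x : I → A} (hx : ∀ i, IsSelfAdjoint (x i)) {b : A}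
    (hb : b ∈ StarAlgebra.adjoin ℂ (Set.range x)) : ∃ p, FreeAlgebra.lift ℂ x p = b := by
  have star_range : star (Set.range x) = Set.range x := by
    rw [← Set.image_star, ← Set.range_comp]
    exact congrArg Set.range (funext fun i => (hx i).star_eq)
  rw [← StarSubalgebra.mem_toSubalgebra, StarAlgebra.adjoin_toSubalgebra, star_range,
    Set.union_self, Algebra.adjoin_range_eq_range_freeAlgebra_lift] at hb
  exact hb

namespace TracialState

section Dense

variable {A U : Type*} [Ring A] [StarRing A] [Algebra ℂ A] [Ring U]
  [StarRing U] [Algebra ℂ U] [StarModule ℂ U] {τ : TracialState A} {υ : TracialState U}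
  {S : Set A}

theorem starAlgHom_ext_of_dense (hυ : υ.IsFaithful)
    (hS : ∀ a, ∀ ε > 0, ∃ b ∈ S, τ.twoNorm (a - b) < ε) {ρ ρ' : A →⋆ₐ[ℂ] U}
    (hρ : ∀ a, υ (ρ a) = τ a) (hρ' : ∀ a, υ (ρ' a) = τ a) (h : ∀ b ∈ S, ρ b = ρ' b) :
    ρ = ρ' := by
  ext a
  refine hυ.eq_of_twoNorm_sub_eq_zero (le_antisymm ?_ (υ.twoNorm_nonneg _))
  refine le_of_forall_pos_lt_add fun ε hε => ?_
  obtain ⟨b, hb, hab⟩ := hS a (ε / 2) (half_pos hε)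
  calc υ.twoNorm (ρ a - ρ' a) = ‖υ.toL2 (ρ (a - b)) - υ.toL2 (ρ' (a - b))‖ := by
        rw [← map_sub, norm_toL2, map_sub ρ, map_sub ρ', h b hb, sub_sub_sub_cancel_right]
    _ ≤ ‖υ.toL2 (ρ (a - b))‖ + ‖υ.toL2 (ρ' (a - b))‖ := norm_sub_le _ _
    _ = τ.twoNorm (a - b) + τ.twoNorm (a - b) := by
        rw [norm_toL2, norm_toL2, twoNorm_map hρ, twoNorm_map hρ']
    _ < 0 + ε := by linarith

theorem twoNorm_eq_of_dense [StarModule ℂ A] {V : Type*} [Ring V] [StarRing V] [Algebra ℂ V]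
    [StarModule ℂ V] {σ : TracialState V}
    (hS : ∀ a, ∀ ε > 0, ∃ b ∈ S, τ.twoNorm (a - b) < ε) {f : A →ₗ[ℂ] U} {g : A →ₗ[ℂ] V}
    (hf : ∀ a, υ.twoNorm (f a) ≤ τ.twoNorm a) (hg : ∀ a, σ.twoNorm (g a) ≤ τ.twoNorm a)
    (h : ∀ b ∈ S, υ.twoNorm (f b) = σ.twoNorm (g b)) (a : A) :
    υ.twoNorm (f a) = σ.twoNorm (g a) := by
  refine eq_of_abs_sub_nonpos (le_of_forall_pos_lt_add fun ε hε => ?_)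
  obtain ⟨b, hb, hab⟩ := hS a (ε / 2) (half_pos hε)
  calc |υ.twoNorm (f a) - σ.twoNorm (g a)|
      ≤ |υ.twoNorm (f a) - υ.twoNorm (f b)| + |σ.twoNorm (g b) - σ.twoNorm (g a)| := by
        rw [h b hb]
        exact abs_sub_le _ _ _
    _ ≤ υ.twoNorm (f (a - b)) + σ.twoNorm (g (b - a)) := by
        rw [map_sub, map_sub]
        exact add_le_add (υ.abs_twoNorm_sub_le _ _) (σ.abs_twoNorm_sub_le _ _)
    _ ≤ τ.twoNorm (a - b) + τ.twoNorm (a - b) := by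
        rw [τ.twoNorm_sub_comm a b]
        exact add_le_add ((hf _).trans_eq (τ.twoNorm_sub_comm a b)) (hg _)
    _ < 0 + ε := by linarith

end Dense

section Generators

variable {A N : Type*} [CStarAlgebra A] [CStarAlgebra N] {τ : TracialState A} {σ : TracialState N}
  {I : Type*} {x : I → A} {y : I → N}

theorem apply_snd_eq_of_mem_closure_adjoin (hx : ∀ i, IsSelfAdjoint (x i))
    (hy : ∀ i, IsSelfAdjoint (y i))
    (htr : ∀ p, σ (FreeAlgebra.lift ℂ y p) = τ (FreeAlgebra.lift ℂ x p)) {g : A × N}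
    (hg : g ∈ (StarAlgebra.adjoin ℂ (Set.range fun i => (x i, y i))).topologicalClosure) :
    σ g.2 = τ g.1 := by
  refine closure_minimal (t := {g : A × N | σ g.2 = τ g.1}) (fun g hg => ?_)
    (isClosed_eq (σ.continuous.comp continuous_snd) (τ.continuous.comp continuous_fst)) hg
  have hxy (i : I) : IsSelfAdjoint (x i, y i) := Prod.ext (hx i) (hy i)
  obtain ⟨p, rfl⟩ := exists_lift_eq_of_mem_adjoin hxy hg
  have fst_lift : (FreeAlgebra.lift ℂ (fun i => (x i, y i)) p).1 = FreeAlgebra.lift ℂ x p :=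
    map_freeAlgebraLift (AlgHom.fst ℂ A N) _ p
  have snd_lift : (FreeAlgebra.lift ℂ (fun i => (x i, y i)) p).2 = FreeAlgebra.lift ℂ y p :=
    map_freeAlgebraLift (AlgHom.snd ℂ A N) _ p
  rw [Set.mem_ofPred_eq, fst_lift, snd_lift, htr]

theorem exists_starAlgHom_of_generators (hσ : σ.BallComplete Set.univ)
    (hx : ∀ i, IsSelfAdjoint (x i)) (hy : ∀ i, IsSelfAdjoint (y i))
    (hdense : ∀ a, ∀ ε > 0, ∃ b ∈ StarAlgebra.adjoin ℂ (Set.range x), τ.twoNorm (a - b) < ε)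
    (htr : ∀ p, σ (FreeAlgebra.lift ℂ y p) = τ (FreeAlgebra.lift ℂ x p))
    {U : Type*} [Ring U] [StarRing U] [Algebra ℂ U] [StarModule ℂ U] {υ : TracialState U}
    (hυ : υ.IsFaithful) (π : N →⋆ₐ[ℂ] U) (hπ : ∀ u, υ (π u) = σ u) :
    ∃ ρ : A →⋆ₐ[ℂ] U, (∀ a, υ (ρ a) = τ a) ∧ ∀ i, ρ (x i) = π (y i) := by
  set G : StarSubalgebra ℂ (A × N) := StarAlgebra.adjoin ℂ (Set.range fun i => (x i, y i)) with hG
  have map_fst : G.map (StarAlgHom.fst ℂ A N) = StarAlgebra.adjoin ℂ (Set.range x) := by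
    rw [hG, StarAlgHom.map_adjoin, ← Set.range_comp]
    rfl
  have dense_fst (a : A) (ε : ℝ) (hε : ε > 0) :
      ∃ g ∈ G.topologicalClosure, τ.twoNorm (a - g.1) < ε := by
    obtain ⟨b, hb, hab⟩ := hdense a ε hε
    rw [← map_fst] at hb
    obtain ⟨g, hg, rfl⟩ := hb
    exact ⟨g, G.le_topologicalClosure hg, hab⟩
  obtain ⟨ρ, hρ, hρG⟩ := exists_starAlgHom_extending_graph hσ G.isClosed_topologicalClosure
    (fun g hg => apply_snd_eq_of_mem_closure_adjoin hx hy htr hg) dense_fst hυ π hπ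
  exact ⟨ρ, hρ, fun i =>
    hρG (x i, y i) (G.le_topologicalClosure (StarAlgebra.subset_adjoin ℂ _ ⟨i, rfl⟩))⟩

end Generators

end TracialState

namespace TracialUltraproduct

theorem exists_starAlgHom_of_tendsto {A I : Type*} [CStarAlgebra A] {τ : TracialState A}
    {x : I → A} (hx : ∀ i, IsSelfAdjoint (x i))
    (hdense : ∀ a, ∀ ε > 0, ∃ b ∈ StarAlgebra.adjoin ℂ (Set.range x), τ.twoNorm (a - b) < ε)
    {B : ℕ → Type*} [∀ k, CStarAlgebra (B k)] (σ : ∀ k, TracialState (B k)) {ω : Ultrafilter ℕ}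
    (hω : (ω : Filter ℕ) ≤ atTop) {y : I → boundedSeq B} (hy : ∀ i, IsSelfAdjoint (y i))
    (hlim : ∀ p, Tendsto (fun k => σ k ((FreeAlgebra.lift ℂ y p).1 k)) ω
      (𝓝 (τ (FreeAlgebra.lift ℂ x p)))) :
    ∃ ρ : A →⋆ₐ[ℂ] TracialUltraproduct σ ω,
      (∀ a, trace σ ω (ρ a) = τ a) ∧ ∀ i, ρ (x i) = mk σ ω (y i) := by
  have (k : ℕ) : Nontrivial (B k) := (σ k).nontrivial
  let e := (lpEquivBoundedSeq B).symm
  have lpTrace_lift (p : FreeAlgebra ℂ I) :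
      lpTrace σ ω (FreeAlgebra.lift ℂ (fun i => e (y i)) p) = τ (FreeAlgebra.lift ℂ x p) := by
    rw [← map_freeAlgebraLift e]
    exact limTrace_eq σ ω (hlim p)
  exact TracialState.exists_starAlgHom_of_generators (ballComplete_lpTrace σ ω hω) hx
    (fun i => (hy i).map e) hdense lpTrace_lift (isFaithful_trace σ ω) (ofLp σ ω) fun _ => rfl

end TracialUltraproduct

/-! ### Random models -/

theorem tendsto_integral_of_tendstoInMeasure {Ω E : Type*} [MeasurableSpace Ω] {μ : Measure Ω}
    [NormedAddCommGroup E] [NormedSpace ℝ E] {f : ℕ → Ω → E} {g : Ω → E} {bound : Ω → ℝ}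
    (hf : ∀ k, AEStronglyMeasurable (f k) μ) (hbound : Integrable bound μ)
    (hle : ∀ k, ∀ᵐ w ∂μ, ‖f k w‖ ≤ bound w) (h : TendstoInMeasure μ f atTop g) :
    Tendsto (fun k => ∫ w, f k w ∂μ) atTop (𝓝 (∫ w, g w ∂μ)) := by
  refine tendsto_of_subseq_tendsto fun ns hns => ?_
  have h_subseq : TendstoInMeasure μ (fun k => f (ns k)) atTop g := fun ε hε => (h ε hε).comp hns
  obtain ⟨ms, -, hms⟩ := h_subseq.exists_seq_tendsto_ae
  exact ⟨ms, tendsto_integral_of_dominated_convergence bound (fun _ => hf _) hbound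
    (fun _ => hle _) hms⟩

section BoundedModel

variable {Ω : Type*} [MeasurableSpace Ω] {μ : Measure Ω} {A : ℕ → Type*} [∀ k, CStarAlgebra (A k)]
  {I : Type*} {X : ∀ k, I → Ω → A k}

/-- The sequence `(X k i)_k` of almost surely uniformly bounded random variables, as a bounded
sequence in the algebras `L^∞(Ω, A k)`. -/
def modelSeq (hX : ∀ k i, AEStronglyMeasurable (X k i) μ) {R : I → ℝ}
    (hb : ∀ k i, ∀ᵐ w ∂μ, ‖X k i w‖ ≤ R i) (i : I) : boundedSeq fun k => Linfty μ (A k) :=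
  ⟨fun k => Linfty.ofBounded (X k i) (hX k i) ⟨R i, hb k i⟩, |R i|, fun k => by
    refine Linfty.norm_le (abs_nonneg _) ?_
    filter_upwards [hb k i, Linfty.coeFn_ofBounded (X k i) (hX k i) ⟨R i, hb k i⟩] with w hw h_coe
    rw [h_coe]
    exact hw.trans (le_abs_self _)⟩

variable (hX : ∀ k i, AEStronglyMeasurable (X k i) μ) {R : I → ℝ}
  (hb : ∀ k i, ∀ᵐ w ∂μ, ‖X k i w‖ ≤ R i)

theorem coeFn_modelSeq (i : I) (k : ℕ) : (modelSeq hX hb i).1 k =ᵐ[μ] X k i :=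
  Linfty.coeFn_ofBounded (X k i) (hX k i) ⟨R i, hb k i⟩

theorem isSelfAdjoint_modelSeq (hsa : ∀ k i, ∀ᵐ w ∂μ, IsSelfAdjoint (X k i w)) (i : I) :
    IsSelfAdjoint (modelSeq hX hb i) := by
  refine Subtype.ext (funext fun k => Linfty.ext_ae ?_)
  filter_upwards [Linfty.coeFn_star ((modelSeq hX hb i).1 k), coeFn_modelSeq hX hb i k, hsa k i]
    with w h_star h_coe hw
  exact h_star.trans (by rw [h_coe, hw.star_eq])

theorem coeFn_lift_modelSeq (p : FreeAlgebra ℂ I) (k : ℕ) :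
    (FreeAlgebra.lift ℂ (modelSeq hX hb) p).1 k =ᵐ[μ]
      fun w => FreeAlgebra.lift ℂ (fun i => X k i w) p := by
  have apply_lift : (FreeAlgebra.lift ℂ (modelSeq hX hb) p).1 k =
      FreeAlgebra.lift ℂ (fun i => (modelSeq hX hb i).1 k) p :=
    map_freeAlgebraLift ((Pi.evalAlgHom ℂ (fun k => Linfty μ (A k)) k).comp
      (boundedSeq fun k => Linfty μ (A k)).subtype.toAlgHom) _ p
  rw [apply_lift]
  exact Linfty.coeFn_lift (coeFn_modelSeq hX hb · k) p

theorem Linfty.tendsto_tracialState_of_tendstoInMeasure [IsProbabilityMeasure μ]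
    (τ : ∀ k, TracialState (A k)) (b : boundedSeq fun k => Linfty μ (A k)) {c : ℂ}
    (h : TendstoInMeasure μ (fun k w => τ k (b.1 k w)) atTop fun _ => c) :
    Tendsto (fun k => Linfty.tracialState μ (τ k) (b.1 k)) atTop (𝓝 c) := by
  obtain ⟨C, hC⟩ := b.2
  rw [show 𝓝 c = 𝓝 (∫ _, c ∂μ) by rw [integral_const, probReal_univ, one_smul]]
  refine tendsto_integral_of_tendstoInMeasure
    (fun k => (τ k).continuous.comp_aestronglyMeasurable (b.1 k).aesm) (integrable_const C)
    (fun k => ?_) h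
  filter_upwards [(b.1 k).ae_norm_le] with w hw
  exact ((τ k).norm_apply_le _).trans (hw.trans (hC k))

end BoundedModel

section MatrixModel

open TracialUltraproduct

variable {n : ℕ → ℕ} [∀ k, NeZero (n k)] {Ω : Type*} [MeasurableSpace Ω] {μ : Measure Ω}
  [IsProbabilityMeasure μ] {I : Type*} {X : ∀ k, I → Ω → Matrix (Fin (n k)) (Fin (n k)) ℂ}

theorem existsUnique_condExp_deterministicInclusion (ω : Ultrafilter ℕ) :
    ∃! F : RandomMatrixUltraproduct n μ ω →ₗ[ℂ] MatrixUltraproduct n ω,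
      IsTracialCondExp (randomTrace n μ ω) (deterministicInclusion n μ ω) F := by
  obtain ⟨F, hF⟩ := exists_isTracialCondExp_map _ ω _ _
    (fun k a => Linfty.tracialState_const (μ := μ) (matrixTrace (n k)) a)
    (fun k => Linfty.isTracialCondExp_expectation (matrixTrace (n k)))
    (fun k => Linfty.norm_expectation_le)
  exact ⟨F, hF, fun F' hF' =>
    IsTracialCondExp.unique (isFaithful_trace _ ω) (map_injective _ ω _ _ _) hF' hF⟩

variable (hX : ∀ k i, AEStronglyMeasurable (X k i) μ) {R : I → ℝ}
  (hb : ∀ k i, ∀ᵐ w ∂μ, ‖X k i w‖ ≤ R i)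

theorem tendsto_tracialState_lift_modelSeq {A : Type*} [Ring A] [StarRing A] [Algebra ℂ A]
    {τ : TracialState A} {x : I → A} (hlaw : ConvergesInLaw τ x μ X) (p : FreeAlgebra ℂ I) :
    Tendsto (fun k => Linfty.tracialState μ (matrixTrace (n k))
      ((FreeAlgebra.lift ℂ (modelSeq hX hb) p).1 k)) atTop (𝓝 (τ (FreeAlgebra.lift ℂ x p))) := by
  refine Linfty.tendsto_tracialState_of_tendstoInMeasure _ _ ((hlaw p).congr_left fun k => ?_)
  exact (coeFn_lift_modelSeq hX hb p k).symm.fun_comp (matrixTrace (n k))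

variable {ω : Ultrafilter ℕ}

namespace IsInducedEmbedding

variable {A : Type*} [Ring A] [StarRing A] [Algebra ℂ A] {τ : TracialState A} {x : I → A}
  {ρ : A →⋆ₐ[ℂ] RandomMatrixUltraproduct n μ ω}

theorem map_lift (hρ : IsInducedEmbedding ω τ x (modelElement ω hX hb) ρ) (p : FreeAlgebra ℂ I) :
    ρ (FreeAlgebra.lift ℂ x p) =
      TracialUltraproduct.mk _ ω (FreeAlgebra.lift ℂ (modelSeq hX hb) p) := by
  rw [map_freeAlgebraLift, map_freeAlgebraLift]
  exact congrArg (FreeAlgebra.lift ℂ · p) (funext hρ.map_generator)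

theorem tendsto_twoNorm_integral_lift
    (hρ : IsInducedEmbedding ω τ x (modelElement ω hX hb) ρ)
    {F : RandomMatrixUltraproduct n μ ω →ₗ[ℂ] MatrixUltraproduct n ω}
    (hF : IsTracialCondExp (randomTrace n μ ω) (deterministicInclusion n μ ω) F)
    (p : FreeAlgebra ℂ I) :
    Tendsto (fun k => (matrixTrace (n k)).twoNorm
      (∫ w, FreeAlgebra.lift ℂ (fun i => X k i w) p ∂μ)) ω
      (𝓝 ((randomTrace n μ ω).twoNorm
        (deterministicInclusion n μ ω (F (ρ (FreeAlgebra.lift ℂ x p)))))) := by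
  rw [hρ.map_lift hX hb p]
  refine (tendsto_twoNorm_condExp _ ω _ _
    (fun k a => Linfty.tracialState_const (matrixTrace (n k)) a)
    (fun k => Linfty.isTracialCondExp_expectation (matrixTrace (n k)))
    (fun k => Linfty.norm_expectation_le) hF _).congr fun k => ?_
  exact congrArg _ (integral_congr_ae (coeFn_lift_modelSeq hX hb p k))

end IsInducedEmbedding

section Embedding

variable {A : Type*} [CStarAlgebra A] {τ : TracialState A} {x : I → A}

theorem existsUnique_isInducedEmbedding (hx : ∀ i, IsSelfAdjoint (x i))
    (hdense : ∀ a, ∀ ε > 0, ∃ b ∈ StarAlgebra.adjoin ℂ (Set.range x), τ.twoNorm (a - b) < ε)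
    (hsa : ∀ k i, ∀ᵐ w ∂μ, (X k i w).IsHermitian) (hlaw : ConvergesInLaw τ x μ X)
    (hω : (ω : Filter ℕ) ≤ atTop) :
    ∃! ρ : A →⋆ₐ[ℂ] RandomMatrixUltraproduct n μ ω,
      IsInducedEmbedding ω τ x (modelElement ω hX hb) ρ := by
  obtain ⟨ρ, trace_preserving, map_generator⟩ := exists_starAlgHom_of_tendsto hx hdense _ hω
    (isSelfAdjoint_modelSeq hX hb hsa)
    fun p => (tendsto_tracialState_lift_modelSeq hX hb hlaw p).mono_left hω
  have hρ : IsInducedEmbedding ω τ x (modelElement ω hX hb) ρ := ⟨trace_preserving, map_generator⟩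
  refine ⟨ρ, hρ, fun ρ' hρ' => TracialState.starAlgHom_ext_of_dense (isFaithful_trace _ ω) hdense
    hρ'.trace_preserving hρ.trace_preserving fun b hb_mem => ?_⟩
  obtain ⟨p, rfl⟩ := exists_lift_eq_of_mem_adjoin hx hb_mem
  rw [hρ.map_lift hX hb p, hρ'.map_lift hX hb p]

end Embedding

section Equivalence

variable {A B : Type*} [Ring A] [StarRing A] [Algebra ℂ A] [Ring B] [StarRing B] [Algebra ℂ B]
  {τ : TracialState A} {x : I → A} {ι : B →⋆ₐ[ℂ] A} {E : A →ₗ[ℂ] B}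

theorem ExternalAveragingProperty.intertwines [StarModule ℂ A] (hx : ∀ i, IsSelfAdjoint (x i))
    (hdense : ∀ a, ∀ ε > 0, ∃ b ∈ StarAlgebra.adjoin ℂ (Set.range x), τ.twoNorm (a - b) < ε)
    (hE : IsTracialCondExp τ ι E) (h : ExternalAveragingProperty τ x ι E μ X)
    (hω : (ω : Filter ℕ) ≤ atTop) {ρ : A →⋆ₐ[ℂ] RandomMatrixUltraproduct n μ ω}
    (hρ : IsInducedEmbedding ω τ x (modelElement ω hX hb) ρ)
    {F : RandomMatrixUltraproduct n μ ω →ₗ[ℂ] MatrixUltraproduct n ω}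
    (hF : IsTracialCondExp (randomTrace n μ ω) (deterministicInclusion n μ ω) F) (z : A) :
    deterministicInclusion n μ ω (F (ρ z)) = ρ (ι (E z)) := by
  refine IsTracialCondExp.intertwines_of_twoNorm_eq hE hF (isFaithful_trace _ ω)
    hρ.trace_preserving (fun a => ?_) z
  refine TracialState.twoNorm_eq_of_dense hdense
    (f := (deterministicInclusion n μ ω).toAlgHom.toLinearMap ∘ₗ F ∘ₗ ρ.toAlgHom.toLinearMap)
    (g := ι.toAlgHom.toLinearMap ∘ₗ E)
    (fun a => ?_) hE.twoNorm_incl_apply_le (fun b hb_mem => ?_) a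
  · exact (hF.twoNorm_incl_apply_le (ρ a)).trans_eq
      (TracialState.twoNorm_map hρ.trace_preserving a)
  · obtain ⟨p, rfl⟩ := exists_lift_eq_of_mem_adjoin hx hb_mem
    exact tendsto_nhds_unique (hρ.tendsto_twoNorm_integral_lift hX hb hF p)
      ((h p).mono_left hω)

theorem externalAveragingProperty_of_intertwines
    (h : ∀ ω : Ultrafilter ℕ, (ω : Filter ℕ) ≤ atTop →
      ∃ ρ : A →⋆ₐ[ℂ] RandomMatrixUltraproduct n μ ω,
        IsInducedEmbedding ω τ x (modelElement ω hX hb) ρ ∧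
      ∃ F : RandomMatrixUltraproduct n μ ω →ₗ[ℂ] MatrixUltraproduct n ω,
        IsTracialCondExp (randomTrace n μ ω) (deterministicInclusion n μ ω) F ∧
        ∀ z, deterministicInclusion n μ ω (F (ρ z)) = ρ (ι (E z))) :
    ExternalAveragingProperty τ x ι E μ X := by
  refine fun p => (tendsto_iff_ultrafilter _ _ _).2 fun ω hω => ?_
  obtain ⟨ρ, hρ, F, hF, intertwines⟩ := h ω hω
  have h_lim := hρ.tendsto_twoNorm_integral_lift hX hb hF p
  rwa [intertwines, TracialState.twoNorm_map hρ.trace_preserving] at h_lim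

end Equivalence

end MatrixModel

end

theorem mainTheorem11
    {H : Type*} [NormedAddCommGroup H] [InnerProductSpace ℂ H] [CompleteSpace H]
    -- the tracial von Neumann algebra `(M, τ)` and the subalgebra `P`
    (M : VonNeumannAlgebra H) (τ : TracialState M.toStarSubalgebra)
    (hfaithful : τ.IsFaithful) (hnormal : IsNormalState M τ)
    (P : VonNeumannAlgebra H) (hPM : P ≤ M)
    -- self-adjoint generators `x` of `M`
    {I : Type*} (x : I → M.toStarSubalgebra) (hx : ∀ i, IsSelfAdjoint (x i))
    (hgen : GeneratedBy M x)
    (R : I → ℝ) (hR : ∀ i, 0 < R i) (hxR : ∀ i, ‖(x i : H →L[ℂ] H)‖ ≤ R i)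
    -- the random matrix models `X k`
    (n : ℕ → ℕ) [∀ k, NeZero (n k)]
    {Ω : Type*} [MeasurableSpace Ω] (μ : Measure Ω) [IsProbabilityMeasure μ]
    (X : ∀ k, I → Ω → Matrix (Fin (n k)) (Fin (n k)) ℂ)
    (hXmeas : ∀ k i, AEStronglyMeasurable (X k i) μ)
    (hXsa : ∀ k i, ∀ᵐ w ∂μ, (X k i w).IsHermitian)
    (hXR : ∀ k i, ∀ᵐ w ∂μ, ‖X k i w‖ ≤ R i)
    (hXlaw : ConvergesInLaw τ x μ X) :
    -- `E_P`, and for every free ultrafilter `ω` also `ρ_ω` and `E_ω`, exist and are unique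
    (∃! E : M.toStarSubalgebra →ₗ[ℂ] P.toStarSubalgebra,
      IsTracialCondExp τ (vnInclusion hPM) E) ∧
    (∀ ω : Ultrafilter ℕ, (ω : Filter ℕ) ≤ cofinite →
      (∃! ρ : M.toStarSubalgebra →⋆ₐ[ℂ] RandomMatrixUltraproduct n μ ω,
        IsInducedEmbedding ω τ x (modelElement ω hXmeas hXR) ρ) ∧
      (∃! F : RandomMatrixUltraproduct n μ ω →ₗ[ℂ] MatrixUltraproduct n ω,
        IsTracialCondExp (randomTrace n μ ω) (deterministicInclusion n μ ω) F)) ∧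
    -- the equivalence
    ∀ E : M.toStarSubalgebra →ₗ[ℂ] P.toStarSubalgebra, IsTracialCondExp τ (vnInclusion hPM) E →
      (ExternalAveragingProperty τ x (vnInclusion hPM) E μ X ↔
        ∀ ω : Ultrafilter ℕ, (ω : Filter ℕ) ≤ cofinite →
          ∀ ρ : M.toStarSubalgebra →⋆ₐ[ℂ] RandomMatrixUltraproduct n μ ω,
            IsInducedEmbedding ω τ x (modelElement ω hXmeas hXR) ρ →
          ∀ F : RandomMatrixUltraproduct n μ ω →ₗ[ℂ] MatrixUltraproduct n ω,
            IsTracialCondExp (randomTrace n μ ω) (deterministicInclusion n μ ω) F →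
          ρ '' Set.range (vnInclusion hPM) =
              Set.range ρ ∩ Set.range (deterministicInclusion n μ ω) ∧
            ∀ z : M.toStarSubalgebra,
              deterministicInclusion n μ ω (F (ρ z)) = ρ (vnInclusion hPM (E z))) := by
  let _ := vonNeumannCStarAlgebra M
  have hdense (a) (ε) (hε : ε > 0) := hgen.exists_twoNorm_sub_lt hnormal a hε
  simp only [Nat.cofinite_eq_atTop]
  have existsUnique_embedding (ω : Ultrafilter ℕ) (hω : (ω : Filter ℕ) ≤ atTop) :=
    existsUnique_isInducedEmbedding hXmeas hXR hx hdense hXsa hXlaw hω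
  refine ⟨existsUnique_condExp_vnInclusion hfaithful hnormal hPM, fun ω hω =>
    ⟨existsUnique_embedding ω hω, existsUnique_condExp_deterministicInclusion ω⟩,
    fun E hE => ⟨fun h ω hω ρ hρ F hF => ?_, fun h => ?_⟩⟩
  · have intertwines := h.intertwines hXmeas hXR hx hdense hE hω hρ hF
    exact ⟨IsTracialCondExp.image_range_eq_of_intertwines hE hF intertwines, intertwines⟩
  · refine externalAveragingProperty_of_intertwines hXmeas hXR fun ω hω => ?_
    obtain ⟨ρ, hρ, -⟩ := existsUnique_embedding ω hω
    obtain ⟨F, hF, -⟩ := existsUnique_condExp_deterministicInclusion (n := n) (μ := μ) ω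
    exact ⟨ρ, hρ, F, hF, (h ω hω ρ hρ F hF).2⟩
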